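/- Let $r\ge 1$ be an integer and let $b\ge 1$ be a squarefree integer such that the trinomial $P(X)=X^3+3rbX-b$ is monogenic, i.e. the field $L=\mathbb{Q}(\theta)$ generated by the real zero $\theta$ of $P$ has maximal order $\mathcal{O}_L=\mathbb{Z}[\theta]$. Then $L$ is a complex (simply real) cubic field; regard $L$ as a subfield of $\mathbb{R}$ and write $\alpha',\alpha''$ for the two complex conjugates of $\alpha\in L$. A nonzero $\alpha\in\mathcal{O}_L$ is a *lattice minimum* if there is no nonzero $\nu\in\mathcal{O}_L$ with $|\nu|<|\alpha|$ and $|\nu'|<|\alpha'|$. The *Voronoi chain* is the sequence $(c_i)_{i\in\mathbb{Z}}$ of all positive lattice minima in strictly decreasing order, with $c_0=1$. Its (primitive) *period length* $\ell$ is the least positive integer for which there is a unit $u$ of $\mathcal{O}_L$ with $c_{i+\ell}=u\,c_i$ for all $i\in\mathbb{Z}$. A *fundamental unit* is a unit that together with $-1$ generates the unit group $U_L$. A *differential principal factor* is a nonzero $\alpha\in\mathcal{O}_L$ whose principal ideal is primitive (not divisible by an integer $m\ge 2$), ambiguous ($(\alpha\mathcal{O}_L)^3=n\mathcal{O}_L$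 for some $n\in\mathbb{Z}$), and (as is then automatic) divides the different of $L/\mathbb{Q}$. The chain is called an $\mathrm{M}k$-chain if the non-unit differential principal factors among the positive lattice minima form exactly $k$ orbits under multiplication by the positive units. **Theorem (Parametrized Period).** The Voronoi chain exists, and the following holds. 1. If $b=1$, then $\ell=1$, the chain is an $\mathrm{M}0$-chain, $c_1=\theta$, $c_2=\theta^2$, $c_3=\theta^3=1-3r\theta$, $\mathrm{N}_{L/\mathbb{Q}}(\theta)=1$, and $\theta$ is a fundamental unit of $L$. 2. If $b\ge 2$, put $\varepsilon_0=1-3r\theta$. Then: - if $r<\lceil b/3\rceil$, then $\ell=2$, the chain is an $\mathrm{M}1$-chain, and $c_0=1$, $c_1=\theta$, $c_2=\varepsilon_0$; - if $r\ge\lceil b/3\rceil$, then $\ell=3$, the chain is an $\mathrm{M}2$-chain, and $c_0=1$, $c_1=\theta$, $c_2=\theta^2$, $c_3=\varepsilon_0$; - $\mathrm{N}_{L/\mathbb{Q}}(\theta)=b$, $\mathrm{N}_{L/\mathbb{Q}}(\theta^2)=b^2$, $\mathrm{N}_{L/\mathbb{Q}}(\varepsilon_0)=1$; - $\varepsilon_0$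 is a fundamental unit of $L$, and every lattice minimum that is not a unit is a differential principal factor. -/

import Mathlib

open Polynomial NumberField

/-- The trinomial `X ^ 3 + 3 r b X - b` with integer coefficients. -/
noncomputable def cubicTrinomial (r b : ℕ) : ℤ[X] :=
  X ^ 3 + C (3 * r * b : ℤ) * X - C (b : ℤ)

/-- `α` is a lattice minimum of the maximal order: `α ≠ 0` and the open norm body of `α` contains
no lattice point except `0`. For a simply real cubic field `L` there are two infinite places, the
real one and the complex one, and the norm body is the norm cylinder
`|ν| < |α|`, `|ν'| < |α'|`. -/
def IsLatticeMinimum {L : Type*} [Field L] (α : 𝓞 L) : Prop :=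
  α ≠ 0 ∧ ∀ ν : 𝓞 L, (∀ v : InfinitePlace L, v (ν : L) < v (α : L)) → ν = 0

/-- The lattice minima that are positive with respect to the real embedding `ρ`. -/
def positiveMinima {L : Type*} [Field L] (ρ : L →+* ℝ) : Set (𝓞 L) :=
  {α | IsLatticeMinimum α ∧ 0 < ρ (α : L)}

/-- `c` is the two-sided Voronoi chain `(ν ^ i (1))`, `i ∈ ℤ`, of the maximal order: it starts in
`c 0 = 1`, lists all positive lattice minima, and runs through them in the order of strictly
decreasing height, so that `c (i + 1)` is the lattice minimum that follows `c i`. -/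
structure IsVoronoiChain {L : Type*} [Field L] (ρ : L →+* ℝ) (c : ℤ → 𝓞 L) : Prop where
  zero : c 0 = 1
  strictAnti : StrictAnti fun i => ρ (c i : L)
  range_eq : Set.range c = positiveMinima ρ

/-- `ℓ` is the primitive period length of the chain `c`: the least positive shift of the chain
which is multiplication by a unit. -/
def IsPrimitivePeriodLength {L : Type*} [Field L] (c : ℤ → 𝓞 L) (ℓ : ℕ) : Prop :=
  IsLeast {k : ℕ | 0 < k ∧ ∃ u : (𝓞 L)ˣ, ∀ i : ℤ, c (i + k) = u * c i} ℓ

/-- `ε` is a fundamental unit of a field with unit rank one and torsion units `±1`, that is, the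
unit group is generated by `-1` and `ε`. -/
def IsFundamentalUnit {L : Type*} [Field L] (ε : 𝓞 L) : Prop :=
  ∃ u : (𝓞 L)ˣ, (u : 𝓞 L) = ε ∧ Subgroup.closure {-1, u} = ⊤

/-- `α` generates a principal ideal which is ambiguous with respect to `L / ℚ`: its `d`-th power,
`d = [L : ℚ]`, is the extension of an ideal of `ℤ`. -/
def IsAmbiguousPrincipal {L : Type*} [Field L] [NumberField L] (α : 𝓞 L) : Prop :=
  α ≠ 0 ∧ ∃ n : Ideal ℤ,
    Ideal.span {α} ^ Module.finrank ℚ L = n.map (algebraMap ℤ (𝓞 L))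

/-- `α` is an (absolute) differential principal factor: it generates a primitive ambiguous
principal ideal which divides the different of `L / ℚ`. Primitive means that no integer `m ≥ 2`
divides it. (In a cubic field every primitive ambiguous ideal divides the different.)
Units count as the trivial case. -/
def IsDifferentialPrincipalFactor {L : Type*} [Field L] [NumberField L] (α : 𝓞 L) : Prop :=
  IsAmbiguousPrincipal α ∧ (∀ m : ℕ, (m : 𝓞 L) ∣ α → m = 1) ∧
    Ideal.span {α} ∣ differentIdeal ℤ (𝓞 L)

/-- The orbit of `α` under multiplication by the units that are positive at `ρ`. -/
def positiveUnitOrbit {L : Type*} [Field L] (ρ : L →+* ℝ) (α : 𝓞 L) : Set (𝓞 L) :=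
  {β | ∃ u : (𝓞 L)ˣ, 0 < ρ ((u : 𝓞 L) : L) ∧ β = u * α}

/-- The positive lattice minima form an `M k`-chain: among them there are exactly `k` orbits,
under the positive units, of non-unitary differential principal factors. -/
def IsMChain {L : Type*} [Field L] [NumberField L] (ρ : L →+* ℝ) (k : ℕ) : Prop :=
  {S : Set (𝓞 L) | ∃ α ∈ positiveMinima ρ, ¬ IsUnit α ∧ IsDifferentialPrincipalFactor α ∧
    S = positiveUnitOrbit ρ α}.encard = k

/-! Embed `ℤ[θ]` in `ℝ × ℂ`. The relation `θ³ = b ε`, with `ε = 1 - 3rθ`, makes `ε` a unit, and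
multiplication by a positive unit permutes the positive minima. So it suffices to exhibit one
period: a block from `1` to a unit, with decreasing heights, such that the cylinder spanned by two
successive members (height of the first, radius of the second) contains no nonzero lattice point
(`IsMinimaBlock`). Powers of the unit carry these empty cylinders along the whole chain, and
`IsMinimaBlock.range_chain` shows that no minimum is missed.

Emptiness is an explicit estimate. Since `1/θ = 3r + θ²/b`, division by `θ` or `θ²` turns each
cylinder into one of height `1`, over the lattices with bases `1, θ, θ²/b` and `1, θ/b, θ²/b`. There
`leading_lt` bounds the last coordinate and a few cases remain (`gap_one`, `gap_two_large`,
`gap_two_small`, `gap_three`). The threshold comes from the middle step: after division by `θ`, the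
candidates to follow `1` are `θ` and `ε/θ = θ²/b`, of squared radius about `3rb` and `9r²`. The
first is the smaller one when `b ≤ 3r`, which inserts `θ²` between `θ` and `ε`; otherwise `ε`
follows `θ` at once.

For `b ≥ 2` the interior members are powers of `θ`, hence non-units of norm `b` or `b²`. As units
are minima, this gives the primitive period and the fundamental unit. The same powers divide
`P'(θ)`, which generates the different, and their cubes are integers up to units, so they are
differential principal factors. -/

/-- The squared absolute value of `x + y θ' + z θ' ^ 2`, where `θ'` is a non-real zero of
`X ^ 3 + B X - b` and `T` the real zero. -/
noncomputable def conjNormSq (T B x y z : ℝ) : ℝ :=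
  (x - y * T / 2 - z * (T ^ 2 / 2 + B)) ^ 2 + (y - z * T) ^ 2 * (3 * T ^ 2 / 4 + B)

lemma conjNormSq_neg (T B x y z : ℝ) :
    conjNormSq T B (-x) (-y) (-z) = conjNormSq T B x y z := by
  unfold conjNormSq; ring

/-! ### Real inequalities: the empty cylinders. -/

section Real

variable {T r b : ℝ}

lemma root_lt (hb : 1 ≤ b) (hT : 0 < T) (h : T ^ 3 + 3 * r * b * T = b) :
    3 * r * T < 1 := by
  have h3 : 0 < T ^ 3 := by positivity
  by_contra! hc
  nlinarith

lemma root_le_third (hr : 1 ≤ r) (hT : 0 < T) (h : 3 * r * T < 1) : T < 1 / 3 := by nlinarith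

/-- With `A` the real part of the conjugate and `w = y - zT`, one has `z(3T² + B) - F = -(A +
3Tw/2)`. As `T` is small against `√B`, the cross term costs only a factor `13/12`. -/
lemma leading_bound {B F x y z : ℝ} (hT : 0 < T) (hT3 : T < 1 / 3) (hB : 3 ≤ B)
    (hF : x + y * T + z * T ^ 2 = F) (hF1 : |F| < 1) :
    12 * (z * (3 * T ^ 2 + B) - F) ^ 2 ≤ 13 * conjNormSq T B x y z := by
  subst hF
  unfold conjNormSq
  have h1 : T ^ 2 ≤ 1 / 9 := by nlinarith
  have h2 : 0 ≤ (13 * (3 * T ^ 2 / 4 + B) - 351 * T ^ 2) * (y - z * T) ^ 2 := by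
    apply mul_nonneg _ (sq_nonneg _); nlinarith
  -- The difference of the two sides is exactly `(A - 18Tw)²` plus the term of `h2`; here `351 = 27
  -- + 18²`.
  nlinarith [sq_nonneg ((x - y * T / 2 - z * (T ^ 2 / 2 + B)) - 18 * T * (y - z * T))]

/-- A point with large leading coefficient is outside the norm body. -/
lemma leading_lt {B F x y z m : ℝ} (hT : 0 < T) (hT3 : T < 1 / 3) (hB : 3 ≤ B)
    (hF : x + y * T + z * T ^ 2 = F) (hF1 : |F| < 1) (hm : 1 ≤ m)
    (hG : 13 * conjNormSq T B x y z < 12 * (m - 1) ^ 2) : |z| * B < m := by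
  by_contra! hc
  have h := leading_bound hT hT3 hB hF hF1
  have h1 : m ≤ |z * (3 * T ^ 2 + B)| := by
    rw [abs_mul, abs_of_pos (by positivity : 0 < 3 * T ^ 2 + B)]
    nlinarith [abs_nonneg z, sq_nonneg T, mul_nonneg (abs_nonneg z) (sq_nonneg T)]
  have h2 : m - 1 ≤ |z * (3 * T ^ 2 + B) - F| := by
    have := abs_sub_abs_le_abs_sub (z * (3 * T ^ 2 + B)) F
    linarith
  have h3 : (m - 1) ^ 2 ≤ (z * (3 * T ^ 2 + B) - F) ^ 2 := by
    rw [← sq_abs (z * (3 * T ^ 2 + B) - F)]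
    exact pow_le_pow_left₀ (by linarith) h2 2
  linarith

lemma int_eq_zero_of_abs_lt {z : ℤ} (h : |(z : ℝ)| < 1) : z = 0 := by
  rw [← Int.cast_abs] at h
  exact Int.abs_lt_one_iff.1 (by exact_mod_cast h)

/-- The radius allows only `y = 0, ±1`. For `y = ±1` the height condition makes `x` vanish or have
the sign opposite to `y`, so `|x - ye/2| ≥ e/2` and the point is no closer than `e` itself. -/
lemma binomial_gap {e s : ℝ} {x y : ℤ} (he : 0 < e) (hs : e ^ 2 ≤ s)
    (hF : |(x : ℝ) + y * e| < 1)
    (hG : (x - y * e / 2) ^ 2 + (y : ℝ) ^ 2 * s < e ^ 2 / 4 + s) : x = 0 ∧ y = 0 := by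
  have hs0 : 0 < s := by nlinarith
  have hy : (y : ℝ) ^ 2 < 2 := by
    by_contra! hc
    nlinarith [sq_nonneg ((x : ℝ) - y * e / 2)]
  have hy' : y ^ 2 < 2 := by exact_mod_cast hy
  have hy1 : y < 2 := by nlinarith
  have hy2 : -2 < y := by nlinarith
  obtain ⟨hF1, hF2⟩ := abs_lt.1 hF
  have hcase : y = 0 ∨ y = 1 ∨ y = -1 := by omega
  rcases hcase with rfl | rfl | rfl
  · refine ⟨int_eq_zero_of_abs_lt (by simpa using hF), rfl⟩
  · exfalso
    push_cast at *
    rcases le_or_gt x 0 with hx | hx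
    · have : (x : ℝ) ≤ 0 := by exact_mod_cast hx
      nlinarith
    · have : (1 : ℝ) ≤ x := by exact_mod_cast hx
      linarith
  · exfalso
    push_cast at *
    rcases lt_or_ge x 0 with hx | hx
    · have : (x : ℝ) ≤ -1 := by exact_mod_cast Int.le_sub_one_of_lt hx
      linarith
    · have : (0 : ℝ) ≤ x := by exact_mod_cast hx
      nlinarith

lemma gap_one (hr : 1 ≤ r) (hb : 1 ≤ b) (hT : 0 < T) (h : T ^ 3 + 3 * r * b * T = b)
    {x y z : ℤ} (hF : |(x : ℝ) + y * T + z * T ^ 2| < 1)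
    (hG : conjNormSq T (3 * r * b) x y z < 3 * r * b + T ^ 2) : x = 0 ∧ y = 0 ∧ z = 0 := by
  have hT3 := root_le_third hr hT (root_lt hb hT h)
  have hrb : 1 ≤ r * b := by nlinarith
  have hz : z = 0 := by
    apply int_eq_zero_of_abs_lt
    have := leading_lt (B := 3 * r * b) (m := 3 * r * b) hT hT3 (by linarith) rfl hF (by linarith) (by nlinarith)
    by_contra! hc
    nlinarith
  subst hz
  obtain ⟨h1, h2⟩ := binomial_gap (x := x) (y := y) (s := 3 * T ^ 2 / 4 + 3 * r * b) hT
    (by nlinarith) (by simpa using hF) (by simp [conjNormSq] at hG; linarith)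
  exact ⟨h1, h2, rfl⟩

lemma gap_three (hr : 1 ≤ r) (hb : 1 ≤ b) (hT : 0 < T) (h : T ^ 3 + 3 * r * b * T = b)
    {x y z : ℤ} (hF : |(x : ℝ) + y / b * T + z / b * T ^ 2| < 1)
    (hG : conjNormSq T (3 * r * b) x (y / b) (z / b) < (3 * r * b + T ^ 2) / b ^ 2) :
    x = 0 ∧ y = 0 ∧ z = 0 := by
  have hT3 := root_le_third hr hT (root_lt hb hT h)
  have hrb : 1 ≤ r * b := by nlinarith
  have hb0 : 0 < b := by linarith
  have hz : z = 0 := by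
    apply int_eq_zero_of_abs_lt
    have hle : (3 * r * b + T ^ 2) / b ^ 2 ≤ 3 * r + 1 / 9 := by
      rw [div_le_iff₀ (by positivity)]
      nlinarith [mul_nonneg (by linarith : 0 ≤ b - 1) (by linarith : 0 ≤ r * b)]
    -- The leading coordinate is `z / b`, so `m = B / b = 3r` is what forces `|z| < 1`.
    have := leading_lt (B := 3 * r * b) (m := 3 * r) hT hT3 (by linarith) rfl hF (by linarith) (by nlinarith)
    rw [abs_div, abs_of_pos hb0, div_mul_eq_mul_div, div_lt_iff₀ hb0] at this
    by_contra! hc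
    nlinarith
  subst hz
  obtain ⟨h1, h2⟩ := binomial_gap (x := x) (y := y) (e := T / b)
    (s := (3 * T ^ 2 / 4 + 3 * r * b) / b ^ 2) (by positivity)
    (by rw [div_pow]; gcongr; nlinarith) (by convert hF using 2; push_cast; ring)
    (by
      convert hG using 1
      · simp [conjNormSq]; ring
      · ring)
  exact ⟨h1, h2, rfl⟩

lemma nonpos_of_lt_one {F : ℝ} {x : ℤ} (hF : |(x : ℝ) + F| < 1) (h : 0 ≤ F) : (x : ℝ) ≤ 0 := by
  have h1 := (abs_lt.1 hF).2
  have : x < 1 := by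
    have : (x : ℝ) < 1 := by linarith
    exact_mod_cast this
  exact_mod_cast Int.lt_add_one_iff.1 this

/-- With `e = T / b` the denominators disappear: the conjugate of `θ²/b` has real part `-(Te/2 +
3r)`, and its imaginary part is `-e` times that of `θ'`. -/
lemma scaled_coord {e : ℝ} (x y : ℤ) (hb : 0 < b) (hT : T = e * b)
    (hF : |(x : ℝ) + y * T + 1 / b * T ^ 2| < 1) :
    |(x : ℝ) + (y * T + e * T)| < 1 ∧ conjNormSq T (3 * r * b) x y (1 / b) =
      (x - y * T / 2 - (T * e / 2 + 3 * r)) ^ 2 +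
        (y - e) ^ 2 * (3 * T ^ 2 / 4 + 3 * r * b) := by
  subst hT
  constructor
  · convert hF using 2; field_simp; ring
  · unfold conjNormSq; field_simp

set_option maxHeartbeats 800000 in
lemma gap_two_large_aux (hr : 1 ≤ r) (hb : 1 ≤ b) (hbr : b ≤ 3 * r) (hT : 0 < T)
    (h : T ^ 3 + 3 * r * b * T = b)
    {x y : ℤ} (hF : |(x : ℝ) + y * T + 1 / b * T ^ 2| < 1) :
    3 * r * b + T ^ 2 ≤ conjNormSq T (3 * r * b) x y (1 / b) := by
  have hrT := root_lt hb hT h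
  have hT3 := root_le_third hr hT hrT
  have hrb : 1 ≤ r * b := by nlinarith
  have hb0 : 0 < b := by linarith
  obtain ⟨e, hTdef⟩ : ∃ e, T = e * b := ⟨T / b, by field_simp⟩
  have he : 0 < e := by by_contra! hc; nlinarith
  obtain ⟨hF', hG⟩ := scaled_coord x y hb0 hTdef hF
  rw [hG]
  have heT : e ≤ T := by nlinarith
  have hS : 0 ≤ 3 * T ^ 2 / 4 + 3 * r * b := by nlinarith
  have hA := sq_nonneg (x - y * T / 2 - (T * e / 2 + 3 * r))
  -- For `y ≥ 2` or `y ≤ -1` the imaginary part is already large enough. For `y = 0, 1` the height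
  -- forces `x ≤ 0`, so the real part exceeds `3r` in absolute value, and `9r² ≥ 3rb`.
  have hyc : 2 ≤ y ∨ y ≤ -1 ∨ y = 0 ∨ y = 1 := by omega
  rcases hyc with hy | hy | rfl | rfl
  · have hy' : (2 : ℝ) ≤ y := by exact_mod_cast hy
    have : 2 ≤ (y - e) ^ 2 := by nlinarith
    nlinarith
  · have hy' : (y : ℝ) ≤ -1 := by exact_mod_cast hy
    have : 1 + 2 * e ≤ (y - e) ^ 2 := by nlinarith
    have h2 : (1 + 2 * e) * (3 * T ^ 2 / 4 + 3 * r * b) ≤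
      (y - e) ^ 2 * (3 * T ^ 2 / 4 + 3 * r * b) := by gcongr
    have h3 : 2 * e * (3 * r * b) = 6 * r * T := by rw [hTdef]; ring
    have h4 : 0 ≤ e * T ^ 2 := by positivity
    nlinarith
  · have hx := nonpos_of_lt_one hF' (by push_cast; positivity)
    have h1 : (T * e / 2 + 3 * r) ^ 2 ≤ (x - (0 : ℤ) * T / 2 - (T * e / 2 + 3 * r)) ^ 2 := by
      rw [← neg_sq ((x : ℝ) - _ - _)]
      apply pow_le_pow_left₀ (by positivity)
      push_cast
      nlinarith [mul_pos hT he]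
    have h3 : e ^ 2 * (3 * r * b) = 3 * r * (T * e) := by rw [hTdef]; ring
    have h4 : T * T ≤ (3 * r * e) * T := by
      have : T ≤ 3 * r * e := by rw [hTdef]; nlinarith
      gcongr
    have h5 : 3 * r * b ≤ 9 * r ^ 2 := by nlinarith
    push_cast at *
    nlinarith [sq_nonneg (T * e)]
  · have hx := nonpos_of_lt_one hF' (by push_cast; positivity)
    have h1 : (T / 2 + 3 * r) ^ 2 ≤ (x - (1 : ℤ) * T / 2 - (T * e / 2 + 3 * r)) ^ 2 := by
      rw [← neg_sq ((x : ℝ) - _ - _)]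
      apply pow_le_pow_left₀ (by positivity)
      push_cast
      nlinarith [mul_pos hT he]
    have h5 : 3 * r * b ≤ 9 * r ^ 2 := by nlinarith
    have h6 : 0 ≤ (((1 : ℤ) : ℝ) - e) ^ 2 * (3 * T ^ 2 / 4 + 3 * r * b) :=
      mul_nonneg (sq_nonneg _) hS
    have h7 : T ^ 2 ≤ r * T := by nlinarith
    linarith [sq_nonneg T]

set_option maxHeartbeats 800000 in
lemma gap_two_small_aux (hr : 1 ≤ r) (hb : 3 * r + 1 ≤ b) (hT : 0 < T)
    (h : T ^ 3 + 3 * r * b * T = b)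
    {x y : ℤ} (hF : |(x : ℝ) + y * T + 1 / b * T ^ 2| < 1) :
    ((3 * r * b + T ^ 2) / b) ^ 2 ≤ conjNormSq T (3 * r * b) x y (1 / b) := by
  have hb1 : 1 ≤ b := by linarith
  have hrT := root_lt hb1 hT h
  have hT3 := root_le_third hr hT hrT
  have hb0 : 0 < b := by linarith
  obtain ⟨e, hTdef⟩ : ∃ e, T = e * b := ⟨T / b, by field_simp⟩
  have he : 0 < e := by by_contra! hc; nlinarith
  obtain ⟨hF', hG⟩ := scaled_coord x y hb0 hTdef hF
  -- The bound is the squared radius of `θ²/b` itself, so equality occurs at `x = y = 0` and the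
  -- case `y = 0` has no slack.
  have hD : (3 * r * b + T ^ 2) / b = 3 * r + T * e := by rw [hTdef]; field_simp
  rw [hG, hD]
  have heT : e ≤ T := by nlinarith
  have hS : 9 * r ^ 2 + 3 * r ≤ 3 * T ^ 2 / 4 + 3 * r * b := by nlinarith
  have hDle : (3 * r + T * e) ^ 2 ≤ 9 * r ^ 2 + 3 * r := by
    have h1 : T * e ≤ 1 / 9 := by nlinarith
    have h2 : 0 < T * e := by positivity
    nlinarith
  have hA := sq_nonneg (x - y * T / 2 - (T * e / 2 + 3 * r))
  have hyc : 2 ≤ y ∨ y ≤ -1 ∨ y = 0 ∨ y = 1 := by omega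
  have hlarge : 1 ≤ (y - e) ^ 2 → (3 * r + T * e) ^ 2 ≤
      (x - y * T / 2 - (T * e / 2 + 3 * r)) ^ 2 +
        (y - e) ^ 2 * (3 * T ^ 2 / 4 + 3 * r * b) := by
    intro h1
    nlinarith
  rcases hyc with hy | hy | rfl | rfl
  · have hy' : (2 : ℝ) ≤ y := by exact_mod_cast hy
    exact hlarge (by nlinarith)
  · have hy' : (y : ℝ) ≤ -1 := by exact_mod_cast hy
    exact hlarge (by nlinarith)
  · have hx := nonpos_of_lt_one hF' (by push_cast; positivity)
    have h1 : (T * e / 2 + 3 * r) ^ 2 ≤ (x - (0 : ℤ) * T / 2 - (T * e / 2 + 3 * r)) ^ 2 := by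
      rw [← neg_sq ((x : ℝ) - _ - _)]
      apply pow_le_pow_left₀ (by positivity)
      push_cast
      nlinarith [mul_pos hT he]
    have h3 : e ^ 2 * (3 * r * b) = 3 * r * (T * e) := by rw [hTdef]; ring
    push_cast at *
    nlinarith
  · have hx := nonpos_of_lt_one hF' (by push_cast; positivity)
    have h1 : (T * e + 3 * r) ^ 2 ≤ (x - (1 : ℤ) * T / 2 - (T * e / 2 + 3 * r)) ^ 2 := by
      rw [← neg_sq ((x : ℝ) - _ - _)]
      apply pow_le_pow_left₀ (by positivity)
      have h3 : T * e ≤ T := by nlinarith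
      push_cast
      linarith
    have h6 : 0 ≤ (((1 : ℤ) : ℝ) - e) ^ 2 * (3 * T ^ 2 / 4 + 3 * r * b) :=
      mul_nonneg (sq_nonneg _) (by nlinarith)
    linarith

lemma abs_leading_le_one (hr : 1 ≤ r) (hb : 1 ≤ b) (hT : 0 < T) (h : T ^ 3 + 3 * r * b * T = b)
    {x y z : ℤ} (hF : |(x : ℝ) + y * T + z / b * T ^ 2| < 1)
    (hG : conjNormSq T (3 * r * b) x y (z / b) < (3 * r + 1 / 9) ^ 2) :
    z = 0 ∨ z = 1 ∨ z = -1 := by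
  have hT3 := root_le_third hr hT (root_lt hb hT h)
  have hrb : 1 ≤ r * b := by nlinarith
  have hb0 : 0 < b := by linarith
  -- Twice the value `3r` that would give `|z| < 1`: the larger radius leaves room for `z = ±1`.
  have := leading_lt (B := 3 * r * b) (m := 6 * r) hT hT3 (by linarith) rfl hF (by linarith) (by nlinarith)
  rw [abs_div, abs_of_pos hb0, div_mul_eq_mul_div, div_lt_iff₀ hb0] at this
  have h2 : |(z : ℝ)| < 2 := by
    by_contra! hc
    nlinarith
  rw [← Int.cast_abs] at h2
  have h3 : |z| < 2 := by exact_mod_cast h2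
  have := abs_lt.1 h3
  omega

lemma gap_two_large (hr : 1 ≤ r) (hb : 1 ≤ b) (hbr : b ≤ 3 * r) (hT : 0 < T)
    (h : T ^ 3 + 3 * r * b * T = b)
    {x y z : ℤ} (hF : |(x : ℝ) + y * T + z / b * T ^ 2| < 1)
    (hG : conjNormSq T (3 * r * b) x y (z / b) < 3 * r * b + T ^ 2) :
    x = 0 ∧ y = 0 ∧ z = 0 := by
  have hT3 := root_le_third hr hT (root_lt hb hT h)
  have hrb : 1 ≤ r * b := by nlinarith
  rcases abs_leading_le_one hr hb hT h hF (by nlinarith) with rfl | rfl | rfl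
  · exact gap_one hr hb hT h (by simpa using hF) (by simpa using hG)
  · push_cast at hF hG
    exact absurd hG (not_lt.2 (gap_two_large_aux hr hb hbr hT h hF))
  · rw [← conjNormSq_neg] at hG
    rw [← abs_neg] at hF
    have := gap_two_large_aux (x := -x) (y := -y) hr hb hbr hT h
      (by push_cast; convert hF using 1; push_cast; congr 1; ring)
    push_cast at this
    rw [show -(((-1 : ℤ) : ℝ) / b) = 1 / b by push_cast; ring] at hG
    exact absurd hG (not_lt.2 this)

lemma gap_two_small (hr : 1 ≤ r) (hb : 3 * r + 1 ≤ b) (hT : 0 < T)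
    (h : T ^ 3 + 3 * r * b * T = b)
    {x y z : ℤ} (hF : |(x : ℝ) + y * T + z / b * T ^ 2| < 1)
    (hG : conjNormSq T (3 * r * b) x y (z / b) < ((3 * r * b + T ^ 2) / b) ^ 2) :
    x = 0 ∧ y = 0 ∧ z = 0 := by
  have hb1 : 1 ≤ b := by linarith
  have hT3 := root_le_third hr hT (root_lt hb1 hT h)
  have hb0 : 0 < b := by linarith
  have hle : (3 * r * b + T ^ 2) / b ≤ 3 * r + 1 / 9 := by
    rw [div_le_iff₀ hb0]; nlinarith
  have hle2 : ((3 * r * b + T ^ 2) / b) ^ 2 ≤ (3 * r + 1 / 9) ^ 2 :=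
    pow_le_pow_left₀ (by positivity) hle 2
  rcases abs_leading_le_one hr hb1 hT h hF (by linarith) with rfl | rfl | rfl
  · have hlt : ((3 * r * b + T ^ 2) / b) ^ 2 ≤ 3 * r * b + T ^ 2 := by nlinarith
    exact gap_one hr hb1 hT h (by simpa using hF) (lt_of_lt_of_le (by simpa using hG) hlt)
  · push_cast at hF hG
    exact absurd hG (not_lt.2 (gap_two_small_aux hr hb hT h hF))
  · rw [← conjNormSq_neg] at hG
    rw [← abs_neg] at hF
    have := gap_two_small_aux (x := -x) (y := -y) hr hb hT h
      (by push_cast; convert hF using 1; push_cast; congr 1; ring)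
    push_cast at this
    rw [show -(((-1 : ℤ) : ℝ) / b) = 1 / b by push_cast; ring] at hG
    exact absurd hG (not_lt.2 this)

end Real

/-! ### Periodic chains of minima in `ℝ × ℂ`. -/

section Chain

variable {R : Type*} [CommRing R]

/-- `α` is a minimum of the lattice embedded by `(f, g)` into `ℝ × ℂ`. -/
def IsMinimumOf (f : R →+* ℝ) (g : R →+* ℂ) (α : R) : Prop :=
  α ≠ 0 ∧ ∀ ν : R, |f ν| < |f α| → Complex.normSq (g ν) < Complex.normSq (g α) → ν = 0

/-- The sequence which continues the block `m 0, …, m (ℓ - 1)` by `c (i + ℓ) = u * c i`. -/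
def periodicChain (u : Rˣ) (ℓ : ℕ) (m : ℕ → R) (i : ℤ) : R :=
  ↑(u ^ (i / ℓ)) * m (i % ℓ).toNat

/-- `m 0 = 1, m 1, …, m ℓ = u` have decreasing heights, and there is no nonzero lattice point
in the norm cylinder spanned by two successive members. -/
structure IsMinimaBlock (f : R →+* ℝ) (g : R →+* ℂ) (u : Rˣ) (ℓ : ℕ) (m : ℕ → R) : Prop where
  length_pos : 0 < ℓ
  zero : m 0 = 1
  last : m ℓ = u
  pos : ∀ j ≤ ℓ, 0 < f (m j)
  anti : ∀ j < ℓ, f (m (j + 1)) < f (m j)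
  gap : ∀ j < ℓ, ∀ ν : R, |f ν| < f (m j) →
    Complex.normSq (g ν) < Complex.normSq (g (m (j + 1))) → ν = 0

variable {f : R →+* ℝ} {g : R →+* ℂ} {u : Rˣ} {ℓ : ℕ} {m : ℕ → R}

lemma map_units_zpow (f : R →+* ℝ) (u : Rˣ) (k : ℤ) : f ↑(u ^ k) = f u ^ k := by
  have : f ↑(u ^ k) = ↑(Units.map (f : R →* ℝ) u ^ k) := by rw [← map_zpow]; rfl
  rw [this, Units.val_zpow_eq_zpow_val]; rfl

/-- Equal radii and integral norms make the ratio of heights rational, so `nβ = mγ`. Comparing radii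
again gives `n² = m²`, hence `n = m` by positivity. -/
lemma eq_of_pos_of_normSq_eq (hf : Function.Injective f) (hg : Function.Injective g)
    (hN : ∀ ν : R, ∃ n : ℤ, f ν * Complex.normSq (g ν) = n)
    {β γ : R} (hβ : 0 < f β) (hγ : 0 < f γ)
    (h : Complex.normSq (g β) = Complex.normSq (g γ)) : β = γ := by
  obtain ⟨m, hm⟩ := hN β
  obtain ⟨n, hn⟩ := hN γ
  have hβ0 : β ≠ 0 := by rintro rfl; simp at hβ
  have hq : 0 < Complex.normSq (g β) :=
    Complex.normSq_pos.2 ((map_ne_zero_iff g hg).2 hβ0)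
  have hm0 : (0 : ℝ) < m := hm ▸ mul_pos hβ hq
  have hn0 : (0 : ℝ) < n := hn ▸ mul_pos hγ (h ▸ hq)
  have e1 : f (n * β) = f (m * γ) := by
    simp only [map_mul, map_intCast, ← hm, ← hn, h]; ring
  have e2 := congrArg (fun x => Complex.normSq (g x)) (hf e1)
  simp only [map_mul, map_intCast, h] at e2
  have e3 := mul_right_cancel₀ (h ▸ hq.ne') e2
  simp only [← Complex.ofReal_intCast, Complex.normSq_ofReal] at e3
  have e4 : (n : ℝ) = m := by nlinarith
  apply hf
  rw [← hm, ← hn, h] at e4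
  exact (mul_right_cancel₀ (h ▸ hq.ne') e4).symm

namespace IsMinimaBlock

/-- The value `j = ℓ` is admitted because `m ℓ = u` agrees with the start of the next block; passing
to a successor then needs no case distinction. -/
lemma chain_apply (hm : IsMinimaBlock f g u ℓ m) (k : ℤ) {j : ℕ} (hj : j ≤ ℓ) :
    periodicChain u ℓ m (k * ℓ + j) = ↑(u ^ k) * m j := by
  have hl : (0 : ℤ) < ℓ := by exact_mod_cast hm.length_pos
  unfold periodicChain
  rcases hj.eq_or_lt with rfl | hj
  · have e1 : (k * j + j : ℤ) / j = k + 1 := by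
      rw [← add_one_mul, Int.mul_ediv_cancel _ hl.ne']
    have e2 : (k * j + j : ℤ) % j = 0 := by rw [← add_one_mul, Int.mul_emod_left]
    rw [e1, e2, Int.toNat_zero, hm.zero, hm.last, zpow_add_one]; simp
  · have hj' : (j : ℤ) < ℓ := by exact_mod_cast hj
    have e1 : (k * ℓ + j : ℤ) / ℓ = k := by
      rw [add_comm, Int.add_mul_ediv_right _ _ hl.ne', Int.ediv_eq_zero_of_lt (by positivity) hj',
        zero_add]
    have e2 : (k * ℓ + j : ℤ) % ℓ = j := by
      rw [add_comm, Int.add_mul_emod_self_right, Int.emod_eq_of_lt (by positivity) hj']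
    rw [e1, e2, Int.toNat_natCast]

lemma exists_eq (hm : IsMinimaBlock f g u ℓ m) (i : ℤ) :
    ∃ (k : ℤ) (j : ℕ), j < ℓ ∧ i = k * ℓ + j := by
  have hl : (0 : ℤ) < ℓ := by exact_mod_cast hm.length_pos
  refine ⟨i / ℓ, (i % ℓ).toNat, ?_, ?_⟩
  · have := Int.emod_lt_of_pos i hl
    omega
  · rw [Int.toNat_of_nonneg (Int.emod_nonneg _ hl.ne'), Int.ediv_mul_add_emod]

lemma chain_zero (hm : IsMinimaBlock f g u ℓ m) : periodicChain u ℓ m 0 = 1 := by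
  have := hm.chain_apply 0 (Nat.zero_le ℓ)
  simpa [hm.zero] using this

lemma chain_natCast (hm : IsMinimaBlock f g u ℓ m) {j : ℕ} (hj : j ≤ ℓ) :
    periodicChain u ℓ m j = m j := by
  have := hm.chain_apply 0 hj
  simpa using this

lemma chain_add_length (hm : IsMinimaBlock f g u ℓ m) (i : ℤ) :
    periodicChain u ℓ m (i + ℓ) = u * periodicChain u ℓ m i := by
  obtain ⟨k, j, hj, rfl⟩ := hm.exists_eq i
  rw [show k * ℓ + j + ℓ = (k + 1) * (ℓ : ℤ) + j by ring, hm.chain_apply _ hj.le,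
    hm.chain_apply _ hj.le, zpow_add_one]
  push_cast; ring

lemma unit_pos (hm : IsMinimaBlock f g u ℓ m) : 0 < f u := hm.last ▸ hm.pos ℓ le_rfl

lemma unit_zpow_pos (hm : IsMinimaBlock f g u ℓ m) (k : ℤ) : 0 < f ↑(u ^ k) := by
  rw [map_units_zpow]; exact zpow_pos hm.unit_pos k

lemma chain_pos (hm : IsMinimaBlock f g u ℓ m) (i : ℤ) : 0 < f (periodicChain u ℓ m i) := by
  obtain ⟨k, j, hj, rfl⟩ := hm.exists_eq i
  rw [hm.chain_apply _ hj.le, map_mul]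
  exact mul_pos (hm.unit_zpow_pos k) (hm.pos j hj.le)

lemma chain_anti (hm : IsMinimaBlock f g u ℓ m) :
    StrictAnti fun i => f (periodicChain u ℓ m i) := by
  refine strictAnti_int_of_succ_lt fun i => ?_
  obtain ⟨k, j, hj, rfl⟩ := hm.exists_eq i
  rw [show k * ℓ + j + 1 = k * (ℓ : ℤ) + (j + 1 : ℕ) by push_cast; ring, hm.chain_apply _ hj.le,
    hm.chain_apply _ hj, map_mul, map_mul]
  exact mul_lt_mul_of_pos_left (hm.anti j hj) (hm.unit_zpow_pos k)

lemma chain_gap (hm : IsMinimaBlock f g u ℓ m) (i : ℤ) (ν : R)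
    (h1 : |f ν| < f (periodicChain u ℓ m i))
    (h2 : Complex.normSq (g ν) < Complex.normSq (g (periodicChain u ℓ m (i + 1)))) : ν = 0 := by
  obtain ⟨k, j, hj, rfl⟩ := hm.exists_eq i
  rw [show k * ℓ + j + 1 = k * (ℓ : ℤ) + (j + 1 : ℕ) by push_cast; ring, hm.chain_apply _ hj] at h2
  rw [hm.chain_apply _ hj.le] at h1
  have hν : ν = ↑(u ^ k) * (↑(u ^ k)⁻¹ * ν) := by rw [Units.mul_inv_cancel_left]
  have hp := hm.unit_zpow_pos k
  have hq : 0 < Complex.normSq (g ↑(u ^ k)) := by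
    apply Complex.normSq_pos.2
    have := (u ^ k).isUnit.map g
    exact this.ne_zero
  rw [hν, map_mul f _ (m j), map_mul f, abs_mul, abs_of_pos hp, mul_lt_mul_iff_right₀ hp] at h1
  rw [hν, map_mul g _ (m _), map_mul g,
    map_mul Complex.normSq, map_mul Complex.normSq _ (g (m _)), mul_lt_mul_iff_right₀ hq] at h2
  have := hm.gap j hj _ h1 h2
  rw [hν, this, mul_zero]

lemma chain_isMinimum (hm : IsMinimaBlock f g u ℓ m) (i : ℤ) :
    IsMinimumOf f g (periodicChain u ℓ m i) := by
  have hne : ∀ i, periodicChain u ℓ m i ≠ 0 := by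
    intro i h
    have := hm.chain_pos i
    simp [h] at this
  -- Radii cannot decrease: otherwise `c (i + 1)` would lie in the empty cylinder spanned by `c (i -
  -- 1)` and `c i`.
  have hle : Complex.normSq (g (periodicChain u ℓ m i)) ≤
      Complex.normSq (g (periodicChain u ℓ m (i + 1))) := by
    by_contra! hc
    refine hne (i + 1) (hm.chain_gap (i - 1) _ ?_ (by rwa [sub_add_cancel]))
    rw [abs_of_pos (hm.chain_pos _)]
    exact hm.chain_anti (by omega)
  refine ⟨hne i, fun ν h1 h2 => hm.chain_gap i ν ?_ (h2.trans_le hle)⟩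
  rwa [abs_of_pos (hm.chain_pos _)] at h1

lemma unit_lt_one (hm : IsMinimaBlock f g u ℓ m) : f u < 1 := by
  have h := hm.chain_anti (show (0 : ℤ) < ℓ by exact_mod_cast hm.length_pos)
  simpa [hm.chain_zero, hm.chain_natCast le_rfl, hm.last] using h

/-- Since `0 < f u < 1`, the heights `f u ^ k` are cofinal towards `0` and `∞`; the greatest index
of height at least `t` therefore exists. -/
lemma exists_between (hm : IsMinimaBlock f g u ℓ m) {t : ℝ} (ht : 0 < t) :
    ∃ i, f (periodicChain u ℓ m (i + 1)) < t ∧ t ≤ f (periodicChain u ℓ m i) := by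
  have hval (k : ℤ) : f (periodicChain u ℓ m (k * ℓ)) = f u ^ k := by
    have := hm.chain_apply k (Nat.zero_le ℓ)
    simp only [Nat.cast_zero, add_zero] at this
    rw [this, hm.zero, mul_one, map_units_zpow]
  obtain ⟨n, hn⟩ := exists_pow_lt_of_lt_one ht hm.unit_lt_one
  obtain ⟨p, hp⟩ := exists_pow_lt_of_lt_one (inv_pos.2 ht) hm.unit_lt_one
  obtain ⟨i, hi, hmax⟩ := Int.exists_greatest_of_bdd
    (P := fun i => t ≤ f (periodicChain u ℓ m i))
    ⟨n * ℓ, fun z hz => by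
      by_contra! hc
      have h1 := hm.chain_anti hc
      simp only [hval] at h1
      rw [zpow_natCast] at h1
      linarith⟩
    ⟨(-p) * ℓ, by
      rw [hval, zpow_neg, zpow_natCast]
      exact (le_inv_comm₀ (pow_pos hm.unit_pos p) ht).1 hp.le⟩
  refine ⟨i, ?_, hi⟩
  by_contra! hc
  have := hmax _ hc
  omega

theorem range_chain (hm : IsMinimaBlock f g u ℓ m) (hf : Function.Injective f)
    (hg : Function.Injective g) (hN : ∀ ν : R, ∃ n : ℤ, f ν * Complex.normSq (g ν) = n) :
    Set.range (periodicChain u ℓ m) = {α | IsMinimumOf f g α ∧ 0 < f α} := by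
  ext γ
  constructor
  · rintro ⟨i, rfl⟩
    exact ⟨hm.chain_isMinimum i, hm.chain_pos i⟩
  · rintro ⟨⟨h0, hmin⟩, hpos⟩
    obtain ⟨i, h1, h2⟩ := hm.exists_between hpos
    rcases h2.eq_or_lt with h2 | h2
    · exact ⟨i, (hf h2).symm⟩
    -- The empty cylinder bounds the radius of `γ` below by that of `c (i + 1)`, and minimality of
    -- `γ` bounds it above.
    refine ⟨i + 1, ?_⟩
    have hp := hm.chain_pos (i + 1)
    apply eq_of_pos_of_normSq_eq hf hg hN hp hpos
    apply le_antisymm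
    · by_contra! hc
      exact h0 (hm.chain_gap i γ (by rwa [abs_of_pos hpos]) hc)
    · by_contra! hc
      exact (hm.chain_isMinimum (i + 1)).1
        (hmin _ (by rwa [abs_of_pos hpos, abs_of_pos hp]) hc)

end IsMinimaBlock

/-- Units are lattice minima. -/
lemma isMinimumOf_of_isUnit (hf : Function.Injective f) (hg : Function.Injective g)
    (hN : ∀ ν : R, ∃ n : ℤ, f ν * Complex.normSq (g ν) = n) (w : Rˣ) :
    IsMinimumOf f g (w : R) := by
  have hw : f w ≠ 0 := (w.isUnit.map f).ne_zero
  -- A nonzero element has norm at least `1` in absolute value, so the cylinder of `1` is empty;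
  -- division by `w` reduces to that case.
  have hone : ∀ ν : R, ν ≠ 0 → 1 ≤ |f ν| * Complex.normSq (g ν) := by
    intro ν hν
    obtain ⟨n, hn⟩ := hN ν
    have h1 : f ν * Complex.normSq (g ν) ≠ 0 :=
      mul_ne_zero ((map_ne_zero_iff f hf).2 hν)
        (Complex.normSq_pos.2 ((map_ne_zero_iff g hg).2 hν)).ne'
    rw [← abs_of_nonneg (Complex.normSq_nonneg (g ν)), ← abs_mul, hn, ← Int.cast_abs]
    have : n ≠ 0 := by rintro rfl; exact h1 (by simpa using hn)
    exact_mod_cast Int.one_le_abs this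
  refine ⟨fun h => hw (by rw [h, map_zero]), fun ν h1 h2 => ?_⟩
  by_contra hν
  have hn : (↑w⁻¹ * ν : R) ≠ 0 := by simpa using hν
  have h3 := hone _ hn
  have h4 : 1 ≤ |f ↑w⁻¹| * Complex.normSq (g ↑w⁻¹) :=
    hone _ fun h => (w⁻¹.isUnit.map f).ne_zero (by rw [h, map_zero])
  have h5 : |f ↑w⁻¹| * |f w| = 1 := by rw [← abs_mul, ← map_mul]; simp
  have h6 : Complex.normSq (g ↑w⁻¹) * Complex.normSq (g w) = 1 := by
    rw [← map_mul, ← map_mul]; simp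
  rw [map_mul, abs_mul, map_mul, map_mul] at h3
  have a0 : 0 < |f ↑w⁻¹| := abs_pos.2 (w⁻¹.isUnit.map f).ne_zero
  have b0 : 0 < Complex.normSq (g ↑w⁻¹) := Complex.normSq_pos.2 (w⁻¹.isUnit.map g).ne_zero
  have h7 : |f ↑w⁻¹| * |f ν| < 1 := h5 ▸ mul_lt_mul_of_pos_left h1 a0
  have h8 : Complex.normSq (g ↑w⁻¹) * Complex.normSq (g ν) < 1 :=
    h6 ▸ mul_lt_mul_of_pos_left h2 b0
  have h9 := mul_lt_one_of_nonneg_of_lt_one_left (by positivity) h7 h8.le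
  nlinarith

end Chain

/-- A strictly decreasing enumeration by `ℤ` is determined by its range and its start. -/
lemma eq_of_strictAnti_of_range_eq {α : Type*} {h : α → ℝ} {c d : ℤ → α}
    (hc : StrictAnti fun i => h (c i)) (hd : StrictAnti fun i => h (d i))
    (hr : Set.range c = Set.range d) (h0 : c 0 = d 0) : c = d := by
  have key : ∀ i j, c i = d j → c (i + 1) = d (j + 1) ∧ c (i - 1) = d (j - 1) := by
    intro i j hij
    have hij' : h (c i) = h (d j) := by rw [hij]
    -- Matching indices preserves order in both directions, so nothing can lie strictly between a
    -- matched pair and its neighbours.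
    have tr {k l n p : ℤ} (e1 : h (c k) = h (d l)) (e2 : h (c n) = h (d p)) : k < n ↔ l < p := by
      rw [← hc.lt_iff_gt, ← hd.lt_iff_gt, e1, e2]
    constructor
    · obtain ⟨k, hk⟩ : c (i + 1) ∈ Set.range d := hr ▸ ⟨_, rfl⟩
      obtain ⟨l, hl⟩ : d (j + 1) ∈ Set.range c := hr ▸ ⟨_, rfl⟩
      have hk' : h (c (i + 1)) = h (d k) := by rw [hk]
      have hl' : h (c l) = h (d (j + 1)) := by rw [hl]
      have a1 := tr hij' hk'
      have a2 := tr hij' hl'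
      have a3 := tr hl' hk'
      rw [← hk]; congr 1; omega
    · obtain ⟨k, hk⟩ : c (i - 1) ∈ Set.range d := hr ▸ ⟨_, rfl⟩
      obtain ⟨l, hl⟩ : d (j - 1) ∈ Set.range c := hr ▸ ⟨_, rfl⟩
      have hk' : h (c (i - 1)) = h (d k) := by rw [hk]
      have hl' : h (c l) = h (d (j - 1)) := by rw [hl]
      have a1 := tr hk' hij'
      have a2 := tr hl' hij'
      have a3 := tr hk' hl'
      rw [← hk]; congr 1; omega
  funext i
  induction i with
  | zero => exact h0
  | succ i ih => exact (key _ _ ih).1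
  | pred i ih => exact (key _ _ ih).2

/-! ### Irreducibility of the trinomial. -/

section Trinomial

lemma cubicTrinomial_eq (r b : ℕ) : cubicTrinomial r b =
    C 1 * X ^ 3 + C 0 * X ^ 2 + C (3 * r * b : ℤ) * X + C (-b : ℤ) := by
  unfold cubicTrinomial
  simp only [map_one, one_mul, map_zero, zero_mul, add_zero, map_neg, sub_eq_add_neg]

lemma natDegree_cubicTrinomial (r b : ℕ) : (cubicTrinomial r b).natDegree = 3 := by
  rw [cubicTrinomial_eq]; exact natDegree_cubic one_ne_zero

lemma monic_cubicTrinomial (r b : ℕ) : (cubicTrinomial r b).Monic := by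
  rw [Monic, cubicTrinomial_eq]; exact leadingCoeff_cubic one_ne_zero

lemma aeval_cubicTrinomial {A : Type*} [CommRing A] (r b : ℕ) (a : A) :
    aeval a (cubicTrinomial r b) = a ^ 3 + 3 * r * b * a - b := by
  simp [cubicTrinomial, map_ofNat]

lemma irreducible_cubicTrinomial {r b : ℕ} (hr : 1 ≤ r) (hb : 1 ≤ b) :
    Irreducible (cubicTrinomial r b) := by
  rw [(monic_cubicTrinomial r b).irreducible_iff_roots_eq_zero_of_degree_le_three
    (by rw [natDegree_cubicTrinomial]; norm_num) (natDegree_cubicTrinomial r b).le]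
  rw [Multiset.eq_zero_iff_forall_notMem]
  intro n hn
  have h := (mem_roots'.1 hn).2
  rw [IsRoot, ← coe_aeval_eq_eval, aeval_cubicTrinomial] at h
  have hb' : (1 : ℤ) ≤ b := by exact_mod_cast hb
  have hr' : (1 : ℤ) ≤ r := by exact_mod_cast hr
  have hrb : (b : ℤ) ≤ r * b := by nlinarith
  rcases le_or_gt n 0 with h0 | h0
  · have : n ^ 3 ≤ 0 := by nlinarith [sq_nonneg n]
    nlinarith
  · have : 0 < n ^ 3 := by positivity
    nlinarith

end Trinomial

/-! ### Integral coordinates, norm and different of `ℤ[θ]`. -/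

section Generator

variable {L : Type*} [Field L] {r b : ℕ} {θ : 𝓞 L}

lemma exists_coord (hroot : aeval θ (cubicTrinomial r b) = 0)
    (hmono : Algebra.adjoin ℤ {θ} = ⊤) (ν : 𝓞 L) :
    ∃ x y z : ℤ, ν = x + y * θ + z * θ ^ 2 := by
  have h : ν ∈ Algebra.adjoin ℤ {θ} := hmono ▸ Algebra.mem_top
  rw [Algebra.adjoin_singleton_eq_range_aeval] at h
  obtain ⟨p, rfl⟩ := h
  set q := p %ₘ cubicTrinomial r b with hq
  have h1 : aeval θ p = aeval θ q := by
    conv_lhs => rw [← modByMonic_add_div p (cubicTrinomial r b)]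
    rw [map_add, map_mul, hroot, zero_mul, add_zero]
  have h2 : q.natDegree < 3 := by
    rw [← natDegree_cubicTrinomial r b]
    exact natDegree_modByMonic_lt p (monic_cubicTrinomial r b) fun h => by
      simpa [h] using natDegree_cubicTrinomial r b
  refine ⟨q.coeff 0, q.coeff 1, q.coeff 2, ?_⟩
  change aeval θ p = _
  rw [h1, aeval_eq_sum_range' h2]
  simp [Finset.sum_range_succ]

lemma map_generator_relation {A : Type*} [CommRing A] (φ : 𝓞 L →+* A)
    (hroot : aeval θ (cubicTrinomial r b) = 0) : φ θ ^ 3 + 3 * r * b * φ θ = b := by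
  rw [aeval_cubicTrinomial] at hroot
  have := congrArg φ hroot
  simp [map_ofNat] at this
  linear_combination this

variable [NumberField L]

lemma minpoly_eq_cubicTrinomial (hr : 1 ≤ r) (hb : 1 ≤ b)
    (hroot : aeval θ (cubicTrinomial r b) = 0) : minpoly ℤ θ = cubicTrinomial r b := by
  have hint := RingOfIntegers.isIntegral θ
  have hdvd := minpoly.isIntegrallyClosed_dvd hint hroot
  refine eq_of_monic_of_associated (minpoly.monic hint) (monic_cubicTrinomial r b) ?_
  exact (minpoly.prime_of_isIntegrallyClosed hint).irreducible.associated_of_dvd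
    (irreducible_cubicTrinomial hr hb) hdvd

lemma minpoly_rat_eq (hr : 1 ≤ r) (hb : 1 ≤ b)
    (hroot : aeval θ (cubicTrinomial r b) = 0) :
    minpoly ℚ (θ : L) = (cubicTrinomial r b).map (algebraMap ℤ ℚ) := by
  rw [← minpoly_eq_cubicTrinomial hr hb hroot]
  exact minpoly.isIntegrallyClosed_eq_field_fractions ℚ L (RingOfIntegers.isIntegral θ)

lemma finrank_eq_three (hr : 1 ≤ r) (hb : 1 ≤ b)
    (hroot : aeval θ (cubicTrinomial r b) = 0)
    (hgen : IntermediateField.adjoin ℚ {(θ : L)} = ⊤) : Module.finrank ℚ L = 3 := by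
  have h := IntermediateField.adjoin.finrank (Algebra.IsIntegral.isIntegral (R := ℚ) (θ : L))
  rw [hgen, IntermediateField.finrank_top', minpoly_rat_eq hr hb hroot,
    (monic_cubicTrinomial r b).natDegree_map, natDegree_cubicTrinomial] at h
  exact h

lemma coord_eq_zero (hr : 1 ≤ r) (hb : 1 ≤ b)
    (hroot : aeval θ (cubicTrinomial r b) = 0) {x y z : ℤ}
    (h : (x : 𝓞 L) + y * θ + z * θ ^ 2 = 0) : x = 0 ∧ y = 0 ∧ z = 0 := by
  have hdvd := minpoly.isIntegrallyClosed_dvd (RingOfIntegers.isIntegral θ)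
    (p := C z * X ^ 2 + C y * X + C x) (by simpa using by linear_combination h)
  rw [minpoly_eq_cubicTrinomial hr hb hroot] at hdvd
  have h0 := eq_zero_of_dvd_of_natDegree_lt hdvd
    ((natDegree_quadratic_le).trans_lt (by rw [natDegree_cubicTrinomial]; norm_num))
  refine ⟨?_, ?_, ?_⟩
  · simpa using congrArg (coeff · 0) h0
  · have := congrArg (coeff · 1) h0
    simp only [coeff_add, coeff_C_mul, coeff_X_pow, coeff_X, coeff_C] at this
    simpa using this
  · have := congrArg (coeff · 2) h0
    simp only [coeff_add, coeff_C_mul, coeff_X_pow, coeff_X, coeff_C] at this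
    simpa using this

lemma norm_generator (hr : 1 ≤ r) (hb : 1 ≤ b)
    (hroot : aeval θ (cubicTrinomial r b) = 0)
    (hmono : Algebra.adjoin ℤ {θ} = ⊤) : Algebra.norm ℤ θ = b := by
  have hint := RingOfIntegers.isIntegral θ
  let pb := (Algebra.adjoin.powerBasis' hint).map
    ((Subalgebra.equivOfEq _ _ hmono).trans Subalgebra.topEquiv)
  have hg : pb.gen = θ := by simp [pb]
  have h := Algebra.PowerBasis.norm_gen_eq_coeff_zero_minpoly pb
  have hd : pb.dim = 3 := by
    rw [← natDegree_cubicTrinomial r b, ← minpoly_eq_cubicTrinomial hr hb hroot]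
    simp [pb]
  rw [hd, hg, minpoly_eq_cubicTrinomial hr hb hroot] at h
  rw [h]
  simp [cubicTrinomial]

lemma differentIdeal_eq (hr : 1 ≤ r) (hb : 1 ≤ b)
    (hroot : aeval θ (cubicTrinomial r b) = 0)
    (hgen : IntermediateField.adjoin ℚ {(θ : L)} = ⊤)
    (hmono : Algebra.adjoin ℤ {θ} = ⊤) :
    differentIdeal ℤ (𝓞 L) = Ideal.span {3 * θ ^ 2 + 3 * (r : 𝓞 L) * b} := by
  have h := conductor_mul_differentIdeal ℤ ℚ L θ (by
    have := congrArg IntermediateField.toSubalgebra hgen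
    rw [IntermediateField.adjoin_simple_toSubalgebra_of_isAlgebraic
      (Algebra.IsAlgebraic.isAlgebraic _)] at this
    exact this)
  rw [conductor_eq_top_of_adjoin_eq_top hmono, Ideal.top_mul,
    minpoly_eq_cubicTrinomial hr hb hroot] at h
  rw [h]
  congr 2
  simp [cubicTrinomial, map_ofNat]

end Generator

/-! ### Conjugates and the norm form. -/

section Embeddings

variable {L : Type*} [Field L] [NumberField L] {r b : ℕ} {θ : 𝓞 L}

lemma normSq_coord {T B s : ℝ} (hs : s ^ 2 = 3 * T ^ 2 / 4 + B) (x y z : ℝ) :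
    Complex.normSq (x + y * ⟨-T / 2, s⟩ + z * ⟨-T / 2, s⟩ ^ 2) = conjNormSq T B x y z := by
  have h : (x + y * ⟨-T / 2, s⟩ + z * ⟨-T / 2, s⟩ ^ 2 : ℂ) =
      ⟨x - y * T / 2 - z * (T ^ 2 / 2 + B), (y - z * T) * s⟩ := by
    apply Complex.ext
    · simp [pow_two]; linear_combination (-z) * hs
    · simp [pow_two]; ring
  rw [h, Complex.normSq_mk, conjNormSq]
  linear_combination (y - z * T) ^ 2 * hs

lemma norm_form {T B b x y z : ℝ} (h : T ^ 3 + B * T = b) :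
    (x + y * T + z * T ^ 2) * conjNormSq T B x y z =
      x ^ 3 - 2 * B * x ^ 2 * z + B * x * y ^ 2 - 3 * b * x * y * z + B ^ 2 * x * z ^ 2 +
        b * y ^ 3 + B * b * y * z ^ 2 + b ^ 2 * z ^ 3 := by
  unfold conjNormSq
  linear_combination (-3 * x * y * z + y ^ 3 + B * y * z ^ 2 + z ^ 3 * (T ^ 3 + B * T + b)) * h

lemma exists_complex_embedding (hr : 1 ≤ r) (hb : 1 ≤ b)
    (hroot : aeval θ (cubicTrinomial r b) = 0) {W : ℂ} (hW : W ^ 3 + 3 * r * b * W - b = 0) :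
    ∃ ψ : L →+* ℂ, ψ θ = W := by
  have h := NumberField.Embeddings.range_eval_eq_rootSet_minpoly L ℂ (θ : L)
  have hmem : W ∈ (minpoly ℚ (θ : L)).rootSet ℂ := by
    rw [mem_rootSet, minpoly_rat_eq hr hb hroot]
    refine ⟨((monic_cubicTrinomial r b).map _).ne_zero, ?_⟩
    rw [aeval_map_algebraMap, aeval_cubicTrinomial, hW]
  rw [← h] at hmem
  exact hmem

lemma complex_root_cases {T B b s : ℝ} (hs : s ^ 2 = 3 * T ^ 2 / 4 + B) (h : T ^ 3 + B * T = b)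
    {W : ℂ} (hW : W ^ 3 + B * W = b) : W = T ∨ W = ⟨-T / 2, s⟩ ∨ W = ⟨-T / 2, -s⟩ := by
  have e : (⟨-T / 2, s⟩ : ℂ) = -T / 2 + s * Complex.I := by
    apply Complex.ext <;> simp
  have e' : (⟨-T / 2, -s⟩ : ℂ) = -T / 2 - s * Complex.I := by
    apply Complex.ext <;> simp
  have hs' : (s : ℂ) ^ 2 = 3 * T ^ 2 / 4 + B := by exact_mod_cast hs
  have h' : (T : ℂ) ^ 3 + B * T = b := by exact_mod_cast h
  have hp : (W - T) * ((W - ⟨-T / 2, s⟩) * (W - ⟨-T / 2, -s⟩)) = 0 := by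
    rw [e, e']
    linear_combination hW - h' + (W - T) * hs' - (W - T) * s ^ 2 * Complex.I_sq
  rcases mul_eq_zero.1 hp with h | h
  · exact Or.inl (sub_eq_zero.1 h)
  · exact Or.inr ((mul_eq_zero.1 h).imp sub_eq_zero.1 sub_eq_zero.1)

end Embeddings

/-! ### Division by `θ`. -/

section Scaling

/-- This is `1/t = 3r + t²/b` applied to the constant coordinate `x`. -/
lemma coord_div {A : Type*} [Field A] {t r b : A} (hb : b ≠ 0) (h : t ^ 3 + 3 * r * b * t = b)
    (x y z : A) : x + y * t + z * t ^ 2 = t * ((y + 3 * r * x) + z * t + x / b * t ^ 2) := by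
  field_simp
  linear_combination (-x) * h

lemma conj_root_relation {T r b s : ℝ} (hs : s ^ 2 = 3 * T ^ 2 / 4 + 3 * r * b)
    (h : T ^ 3 + 3 * r * b * T = b) :
    (⟨-T / 2, s⟩ : ℂ) ^ 3 + 3 * r * b * ⟨-T / 2, s⟩ = b := by
  have h' : (T : ℂ) ^ 3 + 3 * r * b * T = b := by exact_mod_cast h
  have hs' : (s : ℂ) ^ 2 = 3 * T ^ 2 / 4 + 3 * r * b := by exact_mod_cast hs
  have e : (⟨-T / 2, s⟩ : ℂ) = -T / 2 + s * Complex.I := by apply Complex.ext <;> simp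
  rw [e]
  linear_combination h' + (3 * T / 2 - s * Complex.I) * hs' +
    (s ^ 3 * Complex.I - 3 / 2 * T * s ^ 2) * Complex.I_sq

lemma conjNormSq_div {T r b : ℝ} (hb : 0 < b) (hr : 0 ≤ r) (h : T ^ 3 + 3 * r * b * T = b)
    (x y z : ℝ) : conjNormSq T (3 * r * b) x y z =
      (T ^ 2 + 3 * r * b) * conjNormSq T (3 * r * b) (y + 3 * r * x) z (x / b) := by
  obtain ⟨s, hs⟩ : ∃ s : ℝ, s ^ 2 = 3 * T ^ 2 / 4 + 3 * r * b :=
    ⟨√(3 * T ^ 2 / 4 + 3 * r * b), Real.sq_sqrt (by positivity)⟩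
  have h1 := normSq_coord hs 0 1 0
  have h2 : conjNormSq T (3 * r * b) 0 1 0 = T ^ 2 + 3 * r * b := by
    unfold conjNormSq; ring
  rw [h2] at h1
  rw [← h1, ← normSq_coord hs, ← normSq_coord hs, ← map_mul,
    coord_div (Complex.ofReal_ne_zero.2 hb.ne') (conj_root_relation hs h)]
  congr 1
  push_cast
  ring

end Scaling

/-! ### Infinite places as height and radius. -/

section Places

variable {L : Type*} [Field L] {r b : ℕ} {θ : 𝓞 L}

/-- The restriction of an embedding to the maximal order. -/
noncomputable abbrev restrictIntegers {A : Type*} [Semiring A] (φ : L →+* A) : 𝓞 L →+* A :=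
  φ.comp (algebraMap (𝓞 L) L)

lemma restrictIntegers_injective {A : Type*} [Semiring A] [Nontrivial A] (φ : L →+* A) :
    Function.Injective (restrictIntegers φ) :=
  φ.injective.comp RingOfIntegers.coe_injective

lemma normSq_restrict {T s : ℝ} (hs : s ^ 2 = 3 * T ^ 2 / 4 + 3 * r * b) {ψ : L →+* ℂ}
    (hψ : ψ θ = ⟨-T / 2, s⟩) (x y z : ℤ) :
    Complex.normSq (restrictIntegers ψ (x + y * θ + z * θ ^ 2)) =
      conjNormSq T (3 * r * b) x y z := by
  rw [← normSq_coord hs]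
  simp [hψ]

lemma exists_int_norm {ρ : L →+* ℝ} {s : ℝ}
    (hroot : aeval θ (cubicTrinomial r b) = 0) (hmono : Algebra.adjoin ℤ {θ} = ⊤)
    (hs : s ^ 2 = 3 * (ρ θ) ^ 2 / 4 + 3 * r * b) {ψ : L →+* ℂ}
    (hψ : ψ θ = ⟨-ρ θ / 2, s⟩) (ν : 𝓞 L) :
    ∃ n : ℤ, restrictIntegers ρ ν * Complex.normSq (restrictIntegers ψ ν) = n := by
  obtain ⟨x, y, z, rfl⟩ := exists_coord hroot hmono ν
  have hT : ρ θ ^ 3 + 3 * r * b * ρ θ = b := map_generator_relation (restrictIntegers ρ) hroot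
  have e : restrictIntegers ρ (x + y * θ + z * θ ^ 2) = x + y * ρ θ + z * ρ θ ^ 2 := by simp
  rw [normSq_restrict hs hψ, e, norm_form hT]
  exact ⟨x ^ 3 - 2 * (3 * r * b) * x ^ 2 * z + 3 * r * b * x * y ^ 2 - 3 * b * x * y * z +
    (3 * r * b) ^ 2 * x * z ^ 2 + b * y ^ 3 + 3 * r * b * b * y * z ^ 2 + b ^ 2 * z ^ 3,
    by push_cast; rfl⟩

/-- An embedding is determined by the image of `θ`, one of the three zeros, and the two non-real
zeros give the same absolute value. -/
lemma forall_place_lt_iff {ρ : L →+* ℝ} {s : ℝ}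
    (hroot : aeval θ (cubicTrinomial r b) = 0) (hmono : Algebra.adjoin ℤ {θ} = ⊤)
    (hs : s ^ 2 = 3 * (ρ θ) ^ 2 / 4 + 3 * r * b) {ψ : L →+* ℂ}
    (hψ : ψ θ = ⟨-ρ θ / 2, s⟩) (ν α : 𝓞 L) :
    (∀ v : InfinitePlace L, v (ν : L) < v (α : L)) ↔
      |restrictIntegers ρ ν| < |restrictIntegers ρ α| ∧
      Complex.normSq (restrictIntegers ψ ν) < Complex.normSq (restrictIntegers ψ α) := by
  constructor
  · intro h
    refine ⟨by simpa using h (InfinitePlace.mk (Complex.ofRealHom.comp ρ)), ?_⟩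
    rw [Complex.normSq_eq_norm_sq, Complex.normSq_eq_norm_sq]
    exact pow_lt_pow_left₀ (h (InfinitePlace.mk ψ)) (apply_nonneg _ _) two_ne_zero
  · rintro ⟨h1, h2⟩ v
    rw [← InfinitePlace.norm_embedding_eq, ← InfinitePlace.norm_embedding_eq]
    have hφ := map_generator_relation (restrictIntegers v.embedding) hroot
    have hT := map_generator_relation (restrictIntegers ρ) hroot
    have key := complex_root_cases hs hT (W := restrictIntegers v.embedding θ)
      (by push_cast; exact hφ)
    rw [← sq_lt_sq₀ (norm_nonneg _) (norm_nonneg _), ← Complex.normSq_eq_norm_sq,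
      ← Complex.normSq_eq_norm_sq]
    rcases key with key | key | key
    · have e : ∀ μ : 𝓞 L, v.embedding (μ : L) = (restrictIntegers ρ μ : ℂ) := by
        intro μ
        obtain ⟨x, y, z, rfl⟩ := exists_coord hroot hmono μ
        change restrictIntegers v.embedding _ = _
        rw [map_add, map_add, map_mul, map_mul, map_pow, key]
        simp
      rw [e, e, Complex.normSq_ofReal, Complex.normSq_ofReal]
      exact abs_lt_iff_mul_self_lt.1 h1
    all_goals
      have e : ∀ μ : 𝓞 L, Complex.normSq (v.embedding (μ : L)) =
          Complex.normSq (restrictIntegers ψ μ) := by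
        intro μ
        obtain ⟨x, y, z, rfl⟩ := exists_coord hroot hmono μ
        rw [normSq_restrict hs hψ]
        exact normSq_restrict (by simpa using hs) key x y z
      rwa [e, e]

lemma isLatticeMinimum_iff {ρ : L →+* ℝ} {s : ℝ}
    (hroot : aeval θ (cubicTrinomial r b) = 0) (hmono : Algebra.adjoin ℤ {θ} = ⊤)
    (hs : s ^ 2 = 3 * (ρ θ) ^ 2 / 4 + 3 * r * b) {ψ : L →+* ℂ}
    (hψ : ψ θ = ⟨-ρ θ / 2, s⟩) (α : 𝓞 L) :
    IsLatticeMinimum α ↔ IsMinimumOf (restrictIntegers ρ) (restrictIntegers ψ) α := by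
  simp only [IsLatticeMinimum, IsMinimumOf, forall_place_lt_iff hroot hmono hs hψ, and_imp]

end Places

/-! ### Units, period and orbits read off from a block. -/

section Consequences

variable {L : Type*} [Field L] {ρ : L →+* ℝ} {ψ : L →+* ℂ} {u : (𝓞 L)ˣ} {ℓ : ℕ} {m : ℕ → 𝓞 L}

/-- The data making the lattice minima of `𝓞 L` computable from a block of minima. -/
structure IsVoronoiBlock (ρ : L →+* ℝ) (ψ : L →+* ℂ) (u : (𝓞 L)ˣ) (ℓ : ℕ) (m : ℕ → 𝓞 L) : Prop
    extends IsMinimaBlock (restrictIntegers ρ) (restrictIntegers ψ) u ℓ m where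
  int_norm : ∀ ν : 𝓞 L, ∃ n : ℤ,
    restrictIntegers ρ ν * Complex.normSq (restrictIntegers ψ ν) = n
  isLatticeMinimum_iff : ∀ α : 𝓞 L,
    IsLatticeMinimum α ↔ IsMinimumOf (restrictIntegers ρ) (restrictIntegers ψ) α

namespace IsVoronoiBlock

lemma range_chain (h : IsVoronoiBlock ρ ψ u ℓ m) :
    Set.range (periodicChain u ℓ m) = positiveMinima ρ := by
  rw [h.toIsMinimaBlock.range_chain (restrictIntegers_injective ρ)
    (restrictIntegers_injective ψ) h.int_norm]
  ext α
  simp only [positiveMinima, Set.mem_ofPred_eq, h.isLatticeMinimum_iff]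
  rfl

lemma isVoronoiChain (h : IsVoronoiBlock ρ ψ u ℓ m) : IsVoronoiChain ρ (periodicChain u ℓ m) :=
  ⟨h.chain_zero, h.chain_anti, h.range_chain⟩

lemma eq_chain (h : IsVoronoiBlock ρ ψ u ℓ m) {c : ℤ → 𝓞 L} (hc : IsVoronoiChain ρ c) :
    c = periodicChain u ℓ m :=
  eq_of_strictAnti_of_range_eq (h := fun α : 𝓞 L => ρ α) hc.strictAnti h.chain_anti
    (hc.range_eq.trans h.range_chain.symm) (hc.zero.trans h.chain_zero.symm)

lemma exists_eq_of_mem (h : IsVoronoiBlock ρ ψ u ℓ m) {α : 𝓞 L} (hα : α ∈ positiveMinima ρ) :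
    ∃ (k : ℤ) (j : ℕ), j < ℓ ∧ α = ↑(u ^ k) * m j := by
  rw [← h.range_chain] at hα
  obtain ⟨i, rfl⟩ := hα
  obtain ⟨k, j, hj, rfl⟩ := h.exists_eq i
  exact ⟨k, j, hj, h.chain_apply k hj.le⟩

lemma mem_positiveMinima (h : IsVoronoiBlock ρ ψ u ℓ m) {j : ℕ} (hj : j ≤ ℓ) :
    m j ∈ positiveMinima ρ := by
  rw [← h.range_chain, ← h.chain_natCast hj]; exact ⟨_, rfl⟩

/-- A positive unit is a positive minimum, hence some `u ^ k * m j`; the interior `m j` being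
non-units leaves `j = 0`. -/
lemma isFundamentalUnit (h : IsVoronoiBlock ρ ψ u ℓ m)
    (hnu : ∀ j, 0 < j → j < ℓ → ¬ IsUnit (m j)) : IsFundamentalUnit (u : 𝓞 L) := by
  refine ⟨u, rfl, ?_⟩
  have hpos (w : (𝓞 L)ˣ) (hw : 0 < restrictIntegers ρ w) :
      w ∈ Subgroup.closure ({-1, u} : Set (𝓞 L)ˣ) := by
    have hmem : (w : 𝓞 L) ∈ positiveMinima ρ :=
      ⟨(h.isLatticeMinimum_iff _).2 (isMinimumOf_of_isUnit (restrictIntegers_injective ρ)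
        (restrictIntegers_injective ψ) h.int_norm w), hw⟩
    obtain ⟨k, j, hj, e⟩ := h.exists_eq_of_mem hmem
    have hj0 : j = 0 := by
      by_contra hj0
      exact hnu j (by omega) hj (isUnit_of_mul_isUnit_right (e ▸ w.isUnit))
    rw [hj0, h.zero, mul_one] at e
    rw [Units.ext e]
    exact Subgroup.zpow_mem _ (Subgroup.subset_closure (by simp)) k
  rw [eq_top_iff]
  intro w _
  rcases lt_or_gt_of_ne (w.isUnit.map (restrictIntegers ρ)).ne_zero with hw | hw
  · have h1 := hpos (-w) (by rw [Units.val_neg, map_neg]; linarith)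
    have h2 := mul_mem (Subgroup.subset_closure
      (show (-1 : (𝓞 L)ˣ) ∈ ({-1, u} : Set (𝓞 L)ˣ) by simp)) h1
    simpa using h2
  · exact hpos w hw

/-- A shorter shift by a unit, evaluated at index `0`, would make an interior member a unit. -/
lemma isPrimitivePeriodLength (h : IsVoronoiBlock ρ ψ u ℓ m)
    (hnu : ∀ j, 0 < j → j < ℓ → ¬ IsUnit (m j)) :
    IsPrimitivePeriodLength (periodicChain u ℓ m) ℓ := by
  refine ⟨⟨h.length_pos, u, h.chain_add_length⟩, ?_⟩
  rintro k ⟨hk, w, hw⟩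
  by_contra! hc
  have h0 := hw 0
  rw [zero_add, h.chain_natCast hc.le, h.chain_zero, mul_one] at h0
  exact hnu k hk hc (h0 ▸ w.isUnit)

end IsVoronoiBlock

lemma positiveUnitOrbit_self_mem (ρ : L →+* ℝ) (α : 𝓞 L) : α ∈ positiveUnitOrbit ρ α :=
  ⟨1, by simp, by simp⟩

variable [NumberField L]

lemma IsDifferentialPrincipalFactor.of_associated {α β : 𝓞 L} (h : Associated α β)
    (hα : IsDifferentialPrincipalFactor α) : IsDifferentialPrincipalFactor β := by
  have hs : Ideal.span {β} = Ideal.span {α} :=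
    (Ideal.span_singleton_eq_span_singleton.2 h).symm
  obtain ⟨⟨h0, h1⟩, h2, h3⟩ := hα
  exact ⟨⟨h.ne_zero_iff.1 h0, by rwa [hs]⟩, fun k hk => h2 k (h.dvd_iff_dvd_right.2 hk),
    by rwa [hs]⟩

lemma IsVoronoiBlock.orbits_eq (h : IsVoronoiBlock ρ ψ u ℓ m)
    (hnu : ∀ j, 0 < j → j < ℓ → ¬ IsUnit (m j))
    (hd : ∀ j, 0 < j → j < ℓ → IsDifferentialPrincipalFactor (m j)) :
    {S : Set (𝓞 L) | ∃ α ∈ positiveMinima ρ, ¬ IsUnit α ∧ IsDifferentialPrincipalFactor α ∧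
      S = positiveUnitOrbit ρ α} = (fun j => positiveUnitOrbit ρ (m j)) '' Set.Ioo 0 ℓ := by
  ext S
  constructor
  · rintro ⟨α, hα, hα', -, rfl⟩
    obtain ⟨k, j, hj, rfl⟩ := h.exists_eq_of_mem hα
    have hj0 : 0 < j := by
      by_contra! hj0
      obtain rfl : j = 0 := by omega
      rw [h.zero, mul_one] at hα'
      exact hα' (u ^ k).isUnit
    refine ⟨j, ⟨hj0, hj⟩, ?_⟩
    have hk := h.unit_zpow_pos k
    ext β
    constructor
    · rintro ⟨w, hw, rfl⟩
      refine ⟨w * (u ^ k)⁻¹, ?_, by simp [mul_assoc]⟩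
      have := h.unit_zpow_pos (-k)
      rw [zpow_neg] at this
      change 0 < restrictIntegers ρ _
      rw [Units.val_mul, map_mul]
      exact mul_pos hw this
    · rintro ⟨w, hw, rfl⟩
      refine ⟨w * u ^ k, ?_, by push_cast; ring⟩
      change 0 < restrictIntegers ρ _
      rw [Units.val_mul, map_mul]
      exact mul_pos hw hk
  · rintro ⟨j, ⟨hj0, hj⟩, rfl⟩
    exact ⟨m j, h.mem_positiveMinima hj.le, hnu j hj0 hj, hd j hj0 hj, rfl⟩

lemma IsVoronoiBlock.isDifferentialPrincipalFactor (h : IsVoronoiBlock ρ ψ u ℓ m)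
    (hd : ∀ j, 0 < j → j < ℓ → IsDifferentialPrincipalFactor (m j)) {α : 𝓞 L}
    (hα : IsLatticeMinimum α) (hα' : ¬ IsUnit α) : IsDifferentialPrincipalFactor α := by
  have hpos (β : 𝓞 L) (hβ : β ∈ positiveMinima ρ) (hβ' : ¬ IsUnit β) :
      IsDifferentialPrincipalFactor β := by
    obtain ⟨k, j, hj, rfl⟩ := h.exists_eq_of_mem hβ
    have hj0 : 0 < j := by
      by_contra! hj0
      obtain rfl : j = 0 := by omega
      rw [h.zero, mul_one] at hβ'
      exact hβ' (u ^ k).isUnit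
    exact (hd j hj0 hj).of_associated ⟨u ^ k, mul_comm _ _⟩
  have hne : restrictIntegers ρ α ≠ 0 :=
    (map_ne_zero_iff _ (restrictIntegers_injective ρ)).2 hα.1
  rcases lt_or_gt_of_ne hne with hlt | hlt
  · have hneg : -α ∈ positiveMinima ρ := by
      refine ⟨⟨neg_ne_zero.2 hα.1, fun ν hν => hα.2 ν fun v =>
        (hν v).trans_eq (by
        rw [show ((-α : 𝓞 L) : L) = -(α : L) from map_neg _ _]; exact v.1.map_neg _)⟩, ?_⟩
      change 0 < restrictIntegers ρ (-α)
      rw [map_neg]; linarith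
    exact (hpos (-α) hneg (by rwa [IsUnit.neg_iff])).of_associated
      ⟨-1, by simp⟩
  · exact hpos α ⟨hα, hlt⟩ hα'

end Consequences

/-! ### The unit `1 - 3rθ` and the factors `θ`, `θ²`. -/

section Trinomial

variable {L : Type*} [Field L] {r b : ℕ} {θ : 𝓞 L}

lemma cube_eq (hroot : aeval θ (cubicTrinomial r b) = 0) :
    θ ^ 3 = b * (1 - 3 * (r : 𝓞 L) * θ) := by
  have h : θ ^ 3 + 3 * r * b * θ = b := map_generator_relation (RingHom.id _) hroot
  linear_combination h

lemma exists_unit_eq (hroot : aeval θ (cubicTrinomial r b) = 0) :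
    ∃ u : (𝓞 L)ˣ, (u : 𝓞 L) = 1 - 3 * (r : 𝓞 L) * θ := by
  have h := cube_eq hroot
  -- Factor `1 - (3rθ)³` and substitute `(3rθ)³ = 27r³b(1 - 3rθ)`.
  have e : (1 - 3 * (r : 𝓞 L) * θ) *
      (1 + 3 * r * θ + 9 * r ^ 2 * θ ^ 2 + 27 * r ^ 3 * b) = 1 := by
    linear_combination (-27 * (r : 𝓞 L) ^ 3) * h
  exact ⟨Units.mkOfMulEqOne _ _ e, rfl⟩

lemma span_dvd_of_dvd {α β : 𝓞 L} (h : α ∣ β) : Ideal.span {α} ∣ Ideal.span {β} := by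
  obtain ⟨γ, rfl⟩ := h
  exact ⟨Ideal.span {γ}, (Ideal.span_singleton_mul_span_singleton _ _).symm⟩

variable [NumberField L]

lemma not_isUnit_generator (hr : 1 ≤ r) (hb : 2 ≤ b) (hroot : aeval θ (cubicTrinomial r b) = 0)
    (hmono : Algebra.adjoin ℤ {θ} = ⊤) : ¬ IsUnit θ := by
  intro h
  have h1 := h.map (Algebra.norm ℤ)
  rw [norm_generator hr (by omega) hroot hmono, Int.isUnit_iff] at h1
  omega

lemma norm_unit (hr : 1 ≤ r) (hb : 1 ≤ b) (hroot : aeval θ (cubicTrinomial r b) = 0)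
    (hgen : IntermediateField.adjoin ℚ {(θ : L)} = ⊤)
    (hmono : Algebra.adjoin ℤ {θ} = ⊤) : Algebra.norm ℤ (1 - 3 * (r : 𝓞 L) * θ) = 1 := by
  have h := congrArg (Algebra.norm ℤ) (cube_eq hroot)
  have hc : Algebra.norm ℤ (b : 𝓞 L) = (b : ℤ) ^ 3 := by
    have := Algebra.norm_algebraMap (S := 𝓞 L) (b : ℤ)
    rwa [RingOfIntegers.rank, finrank_eq_three hr hb hroot hgen, map_natCast] at this
  rw [map_pow, map_mul, norm_generator hr hb hroot hmono, hc] at h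
  have hb0 : ((b : ℤ) ^ 3) ≠ 0 := by positivity
  exact (mul_left_cancel₀ hb0 (by rw [mul_one]; exact h)).symm

lemma isDifferentialPrincipalFactor_pow (hr : 1 ≤ r) (hb : 1 ≤ b)
    (hroot : aeval θ (cubicTrinomial r b) = 0)
    (hgen : IntermediateField.adjoin ℚ {(θ : L)} = ⊤)
    (hmono : Algebra.adjoin ℤ {θ} = ⊤) {j : ℕ} (hj0 : 0 < j) (hj : j < 3) :
    IsDifferentialPrincipalFactor (θ ^ j) := by
  obtain ⟨u, hu⟩ := exists_unit_eq hroot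
  have h3 := cube_eq hroot
  rw [← hu] at h3
  have hθ : θ ≠ 0 := by
    rintro rfl
    have hb' : (b : 𝓞 L) ≠ 0 := by exact_mod_cast (by omega : b ≠ 0)
    exact mul_ne_zero hb' u.ne_zero (by rw [← h3]; simp)
  refine ⟨⟨pow_ne_zero _ hθ, Ideal.span {(b : ℤ) ^ j}, ?_⟩, ?_, ?_⟩
  · rw [finrank_eq_three hr hb hroot hgen, Ideal.map_span, Set.image_singleton,
      Ideal.span_singleton_pow, Ideal.span_singleton_eq_span_singleton]
    refine Associated.symm ⟨u ^ j, ?_⟩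
    rw [← pow_mul, mul_comm j, pow_mul, h3, mul_pow]
    simp
  -- Primitivity: `θ ^ j` has a coordinate equal to `1` in the basis `1, θ, θ²`.
  · rintro k ⟨ν, hν⟩
    obtain ⟨x, y, z, rfl⟩ := exists_coord hroot hmono ν
    have hk : (k : ℤ) ∣ 1 := by
      obtain rfl | rfl : j = 1 ∨ j = 2 := by omega
      · obtain ⟨-, h, -⟩ := coord_eq_zero hr hb hroot (x := k * x) (y := k * y - 1) (z := k * z)
          (by push_cast; linear_combination -hν)
        exact ⟨y, by linarith⟩
      · obtain ⟨-, -, h⟩ := coord_eq_zero hr hb hroot (x := k * x) (y := k * y) (z := k * z - 1)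
          (by push_cast; linear_combination -hν)
        exact ⟨z, by linarith⟩
    have := Int.eq_one_of_dvd_one (by positivity) hk
    exact_mod_cast this
  · rw [differentIdeal_eq hr hb hroot hgen hmono]
    apply span_dvd_of_dvd
    -- Up to a unit `b` is `θ³`, so `θ²` divides `P'(θ) = 3θ² + 3rb`.
    refine (pow_dvd_pow θ (by omega : j ≤ 2)).trans ⟨3 + 3 * r * θ * ↑u⁻¹, ?_⟩
    have : (b : 𝓞 L) = θ ^ 3 * ↑u⁻¹ := by rw [h3, mul_assoc, Units.mul_inv, mul_one]
    rw [this]; ring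

end Trinomial

/-! ### The three explicit blocks. -/

section Blocks

variable {L : Type*} [Field L] {r b : ℕ} {θ : 𝓞 L} {ρ : L →+* ℝ} {ψ : L →+* ℂ}

/-- The maximal order is `ℤ[θ]` with a zero `θ` of the trinomial, and `ψ` is a complex embedding
that maps `θ` to the conjugate zero in the upper half plane. -/
structure IsTrinomialOrder (ρ : L →+* ℝ) (ψ : L →+* ℂ) (r b : ℕ) (θ : 𝓞 L) : Prop where
  one_le_r : 1 ≤ r
  one_le_b : 1 ≤ b
  root : aeval θ (cubicTrinomial r b) = 0
  mono : Algebra.adjoin ℤ {θ} = ⊤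
  conj : ∃ s : ℝ, s ^ 2 = 3 * (ρ θ) ^ 2 / 4 + 3 * r * b ∧ ψ θ = ⟨-ρ θ / 2, s⟩

namespace IsTrinomialOrder

lemma one_le_r_real (h : IsTrinomialOrder ρ ψ r b θ) : (1 : ℝ) ≤ r := by
  exact_mod_cast h.one_le_r

lemma one_le_b_real (h : IsTrinomialOrder ρ ψ r b θ) : (1 : ℝ) ≤ b := by
  exact_mod_cast h.one_le_b

lemma relation (h : IsTrinomialOrder ρ ψ r b θ) : ρ θ ^ 3 + 3 * r * b * ρ θ = b :=
  map_generator_relation (restrictIntegers ρ) h.root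

lemma pos (h : IsTrinomialOrder ρ ψ r b θ) : 0 < ρ θ := by
  have h0 := h.relation
  have hb := h.one_le_b_real
  by_contra! hc
  have h1 : ρ θ ^ 3 ≤ 0 := by nlinarith [sq_nonneg (ρ θ)]
  have h2 : 3 * (r : ℝ) * b * ρ θ ≤ 0 := mul_nonpos_of_nonneg_of_nonpos (by positivity) hc
  linarith

lemma lt_one (h : IsTrinomialOrder ρ ψ r b θ) : ρ θ < 1 := by
  have := root_le_third h.one_le_r_real h.pos (root_lt h.one_le_b_real h.pos h.relation)
  linarith

lemma height_unit_pos (h : IsTrinomialOrder ρ ψ r b θ) :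
    0 < restrictIntegers ρ (1 - 3 * (r : 𝓞 L) * θ) := by
  have := root_lt h.one_le_b_real h.pos h.relation
  simpa [map_ofNat] using this

/-- Because `ε ≤ bε = θ³ < θ²` at the real place. -/
lemma height_unit_lt (h : IsTrinomialOrder ρ ψ r b θ) :
    restrictIntegers ρ (1 - 3 * (r : 𝓞 L) * θ) < ρ θ ^ 2 := by
  have h1 : ρ θ ^ 3 = b * restrictIntegers ρ (1 - 3 * (r : 𝓞 L) * θ) := by
    simpa using congrArg (restrictIntegers ρ) (cube_eq h.root)
  have h2 : restrictIntegers ρ (1 - 3 * (r : 𝓞 L) * θ) ≤ ρ θ ^ 3 := by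
    nlinarith [h.one_le_b_real, h.height_unit_pos]
  have := pow_lt_pow_right_of_lt_one₀ h.pos h.lt_one (show 2 < 3 by norm_num)
  linarith

lemma normSq_coord (h : IsTrinomialOrder ρ ψ r b θ) (x y z : ℤ) :
    Complex.normSq (restrictIntegers ψ (x + y * θ + z * θ ^ 2)) =
      conjNormSq (ρ θ) (3 * r * b) x y z := by
  obtain ⟨s, hs, hψ⟩ := h.conj
  exact normSq_restrict hs hψ x y z

lemma normSq_generator (h : IsTrinomialOrder ρ ψ r b θ) :
    Complex.normSq (restrictIntegers ψ θ) = ρ θ ^ 2 + 3 * r * b := by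
  have := h.normSq_coord 0 1 0
  simp only [Int.cast_zero, Int.cast_one, zero_add, one_mul, zero_mul, add_zero] at this
  rw [this]; unfold conjNormSq; ring

lemma normSq_unit (h : IsTrinomialOrder ρ ψ r b θ) :
    Complex.normSq (restrictIntegers ψ (1 - 3 * (r : 𝓞 L) * θ)) =
      (ρ θ ^ 2 + 3 * r * b) ^ 3 / b ^ 2 := by
  have hb : (0 : ℝ) < b := by linarith [h.one_le_b_real]
  have h1 := congrArg (fun α => Complex.normSq (restrictIntegers ψ α)) (cube_eq h.root)
  simp only [map_pow, map_mul, h.normSq_generator, map_natCast, Complex.normSq_natCast] at h1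
  rw [h1]; field_simp

lemma gap_one (h : IsTrinomialOrder ρ ψ r b θ) (ν : 𝓞 L) (h1 : |restrictIntegers ρ ν| < 1)
    (h2 : Complex.normSq (restrictIntegers ψ ν) < ρ θ ^ 2 + 3 * r * b) : ν = 0 := by
  obtain ⟨x, y, z, rfl⟩ := exists_coord h.root h.mono ν
  rw [h.normSq_coord] at h2
  obtain ⟨rfl, rfl, rfl⟩ := _root_.gap_one (T := ρ θ) (r := r) (b := b) (x := x) (y := y) (z := z)
    h.one_le_r_real h.one_le_b_real h.pos h.relation (by simpa using h1) (by linarith)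
  simp

lemma height_div (h : IsTrinomialOrder ρ ψ r b θ) (x y z : ℤ) :
    restrictIntegers ρ (x + y * θ + z * θ ^ 2) =
      ρ θ * (((y + 3 * r * x : ℤ) : ℝ) + (z : ℤ) * ρ θ + (x : ℤ) / b * ρ θ ^ 2) := by
  have hb : (b : ℝ) ≠ 0 := by linarith [h.one_le_b_real]
  have := coord_div hb h.relation (x : ℝ) y z
  push_cast
  rw [← this]; simp

lemma normSq_div (h : IsTrinomialOrder ρ ψ r b θ) (x y z : ℤ) :
    Complex.normSq (restrictIntegers ψ (x + y * θ + z * θ ^ 2)) = (ρ θ ^ 2 + 3 * r * b) *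
      conjNormSq (ρ θ) (3 * r * b) ((y + 3 * r * x : ℤ) : ℝ) (z : ℤ) ((x : ℤ) / b) := by
  have hb : (0 : ℝ) < b := by linarith [h.one_le_b_real]
  rw [h.normSq_coord, conjNormSq_div hb (by positivity) h.relation]
  push_cast; rfl

lemma coord_zero_of_div_zero {x y z : ℤ} (h : y + 3 * r * x = 0 ∧ z = 0 ∧ x = 0) :
    (x : 𝓞 L) + y * θ + z * θ ^ 2 = 0 := by
  obtain ⟨h1, rfl, rfl⟩ := h
  obtain rfl : y = 0 := by simpa using h1
  simp

lemma gap_two_large (h : IsTrinomialOrder ρ ψ r b θ) (hbr : b ≤ 3 * r) (ν : 𝓞 L)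
    (h1 : |restrictIntegers ρ ν| < ρ θ)
    (h2 : Complex.normSq (restrictIntegers ψ ν) < (ρ θ ^ 2 + 3 * r * b) ^ 2) : ν = 0 := by
  obtain ⟨x, y, z, rfl⟩ := exists_coord h.root h.mono ν
  have hT := h.pos
  have hQ : 0 < ρ θ ^ 2 + 3 * r * b := by positivity
  rw [h.height_div, abs_mul, abs_of_pos hT, mul_lt_iff_lt_one_right hT] at h1
  rw [h.normSq_div, pow_two (_ + _), mul_lt_mul_iff_right₀ hQ] at h2
  exact coord_zero_of_div_zero (_root_.gap_two_large h.one_le_r_real h.one_le_b_real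
    (by exact_mod_cast hbr) hT h.relation h1 (by linarith))

lemma gap_two_small (h : IsTrinomialOrder ρ ψ r b θ) (hbr : 3 * r + 1 ≤ b) (ν : 𝓞 L)
    (h1 : |restrictIntegers ρ ν| < ρ θ)
    (h2 : Complex.normSq (restrictIntegers ψ ν) < (ρ θ ^ 2 + 3 * r * b) ^ 3 / b ^ 2) : ν = 0 := by
  obtain ⟨x, y, z, rfl⟩ := exists_coord h.root h.mono ν
  have hT := h.pos
  have hQ : 0 < ρ θ ^ 2 + 3 * r * b := by positivity
  rw [h.height_div, abs_mul, abs_of_pos hT, mul_lt_iff_lt_one_right hT] at h1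
  rw [h.normSq_div, show (ρ θ ^ 2 + 3 * r * b) ^ 3 / b ^ 2 = (ρ θ ^ 2 + 3 * r * b) *
    ((3 * r * b + ρ θ ^ 2) / b) ^ 2 by ring, mul_lt_mul_iff_right₀ hQ] at h2
  exact coord_zero_of_div_zero (_root_.gap_two_small h.one_le_r_real
    (by exact_mod_cast hbr) hT h.relation h1 h2)

lemma gap_three (h : IsTrinomialOrder ρ ψ r b θ) (ν : 𝓞 L)
    (h1 : |restrictIntegers ρ ν| < ρ θ ^ 2)
    (h2 : Complex.normSq (restrictIntegers ψ ν) < (ρ θ ^ 2 + 3 * r * b) ^ 3 / b ^ 2) : ν = 0 := by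
  obtain ⟨x, y, z, rfl⟩ := exists_coord h.root h.mono ν
  have hT := h.pos
  have hb : (0 : ℝ) < b := by linarith [h.one_le_b_real]
  have hQ : 0 < ρ θ ^ 2 + 3 * r * b := by positivity
  rw [h.height_div, coord_div hb.ne' h.relation, ← mul_assoc, ← pow_two, abs_mul,
    abs_of_pos (pow_pos hT 2), mul_lt_iff_lt_one_right (pow_pos hT 2)] at h1
  rw [h.normSq_div, conjNormSq_div hb (by positivity) h.relation,
    show (ρ θ ^ 2 + 3 * r * b) ^ 3 / b ^ 2 = (ρ θ ^ 2 + 3 * r * b) * ((ρ θ ^ 2 + 3 * r * b) *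
    ((3 * r * b + ρ θ ^ 2) / b ^ 2)) by ring, mul_lt_mul_iff_right₀ hQ,
    mul_lt_mul_iff_right₀ hQ] at h2
  -- The coordinates after two divisions by `θ`; the second turns the coordinate `x/b` into the
  -- middle one, so the denominators stay equal to `b`.
  obtain ⟨h3, h4, h5⟩ := _root_.gap_three (x := z + 3 * r * (y + 3 * r * x)) (y := x)
    (z := y + 3 * r * x) h.one_le_r_real h.one_le_b_real hT h.relation
    (by push_cast at h1 ⊢; exact h1) (by push_cast at h2 ⊢; exact h2)
  exact coord_zero_of_div_zero ⟨h5, by simpa [h5] using h3, h4⟩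

lemma int_norm (h : IsTrinomialOrder ρ ψ r b θ) (ν : 𝓞 L) :
    ∃ n : ℤ, restrictIntegers ρ ν * Complex.normSq (restrictIntegers ψ ν) = n := by
  obtain ⟨s, hs, hψ⟩ := h.conj
  exact exists_int_norm h.root h.mono hs hψ ν

lemma isLatticeMinimum_iff (h : IsTrinomialOrder ρ ψ r b θ) (α : 𝓞 L) :
    IsLatticeMinimum α ↔ IsMinimumOf (restrictIntegers ρ) (restrictIntegers ψ) α := by
  obtain ⟨s, hs, hψ⟩ := h.conj
  exact _root_.isLatticeMinimum_iff h.root h.mono hs hψ α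

lemma isVoronoiBlock (h : IsTrinomialOrder ρ ψ r b θ) {u : (𝓞 L)ˣ} {ℓ : ℕ} {m : ℕ → 𝓞 L}
    (hm : IsMinimaBlock (restrictIntegers ρ) (restrictIntegers ψ) u ℓ m) :
    IsVoronoiBlock ρ ψ u ℓ m :=
  ⟨hm, h.int_norm, h.isLatticeMinimum_iff⟩

lemma block_one (h : IsTrinomialOrder ρ ψ r b θ) {u : (𝓞 L)ˣ} (hu : (u : 𝓞 L) = θ) :
    IsVoronoiBlock ρ ψ u 1 (fun j => θ ^ j) := by
  refine h.isVoronoiBlock ⟨one_pos, pow_zero _, by simp [hu], ?_, ?_, ?_⟩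
  · intro j _
    rw [map_pow]; exact pow_pos h.pos j
  · intro j hj
    obtain rfl : j = 0 := by omega
    simpa using h.lt_one
  · intro j hj ν h1 h2
    obtain rfl : j = 0 := by omega
    exact h.gap_one ν (by simpa using h1) (by rwa [zero_add, pow_one, h.normSq_generator] at h2)

/-- The default value of `getD` supplies the closing member `m 2 = u`. -/
lemma block_two (h : IsTrinomialOrder ρ ψ r b θ) (hbr : 3 * r + 1 ≤ b) {u : (𝓞 L)ˣ}
    (hu : (u : 𝓞 L) = 1 - 3 * (r : 𝓞 L) * θ) :
    IsVoronoiBlock ρ ψ u 2 (fun j => [1, θ].getD j (1 - 3 * (r : 𝓞 L) * θ)) := by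
  have hlt : ρ θ ^ 2 < ρ θ := by nlinarith [h.pos, h.lt_one]
  refine h.isVoronoiBlock ⟨two_pos, rfl, hu.symm, ?_, ?_, ?_⟩
  · intro j hj
    obtain rfl | rfl | rfl : j = 0 ∨ j = 1 ∨ j = 2 := by omega
    · simp
    · exact h.pos
    · exact h.height_unit_pos
  · intro j hj
    obtain rfl | rfl : j = 0 ∨ j = 1 := by omega
    · simpa using h.lt_one
    · exact h.height_unit_lt.trans hlt
  · intro j hj ν h1 h2
    obtain rfl | rfl : j = 0 ∨ j = 1 := by omega
    · exact h.gap_one ν (by simpa using h1) (by rw [← h.normSq_generator]; exact h2)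
    · exact h.gap_two_small hbr ν h1 (by rw [← h.normSq_unit]; exact h2)

lemma block_three (h : IsTrinomialOrder ρ ψ r b θ) (hbr : b ≤ 3 * r) {u : (𝓞 L)ˣ}
    (hu : (u : 𝓞 L) = 1 - 3 * (r : 𝓞 L) * θ) :
    IsVoronoiBlock ρ ψ u 3 (fun j => [1, θ, θ ^ 2].getD j (1 - 3 * (r : 𝓞 L) * θ)) := by
  have hlt : ρ θ ^ 2 < ρ θ := by nlinarith [h.pos, h.lt_one]
  have hsq : restrictIntegers ρ (θ ^ 2) = ρ θ ^ 2 := map_pow _ _ _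
  refine h.isVoronoiBlock ⟨three_pos, rfl, hu.symm, ?_, ?_, ?_⟩
  · intro j hj
    obtain rfl | rfl | rfl | rfl : j = 0 ∨ j = 1 ∨ j = 2 ∨ j = 3 := by omega
    · simp
    · exact h.pos
    · exact hsq ▸ pow_pos h.pos 2
    · exact h.height_unit_pos
  · intro j hj
    obtain rfl | rfl | rfl : j = 0 ∨ j = 1 ∨ j = 2 := by omega
    · simpa using h.lt_one
    · exact hsq.trans_lt hlt
    · exact h.height_unit_lt.trans_eq hsq.symm
  · intro j hj ν h1 h2
    obtain rfl | rfl | rfl : j = 0 ∨ j = 1 ∨ j = 2 := by omega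
    · exact h.gap_one ν (by simpa using h1) (by rw [← h.normSq_generator]; exact h2)
    · refine h.gap_two_large hbr ν h1 ?_
      rw [← h.normSq_generator, ← map_pow, ← map_pow]; exact h2
    · exact h.gap_three ν (h1.trans_eq hsq) (by rw [← h.normSq_unit]; exact h2)

end IsTrinomialOrder

lemma exists_isTrinomialOrder [NumberField L] (ρ : L →+* ℝ) (hr : 1 ≤ r) (hb : 1 ≤ b)
    (hroot : aeval θ (cubicTrinomial r b) = 0) (hmono : Algebra.adjoin ℤ {θ} = ⊤) :
    ∃ ψ : L →+* ℂ, IsTrinomialOrder ρ ψ r b θ := by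
  obtain ⟨s, hs⟩ : ∃ s : ℝ, s ^ 2 = 3 * (ρ θ) ^ 2 / 4 + 3 * r * b :=
    ⟨√(3 * (ρ θ) ^ 2 / 4 + 3 * r * b), Real.sq_sqrt (by positivity)⟩
  have hT : ρ θ ^ 3 + 3 * r * b * ρ θ = b := map_generator_relation (restrictIntegers ρ) hroot
  obtain ⟨ψ, hψ⟩ := exists_complex_embedding hr hb hroot (W := ⟨-ρ θ / 2, s⟩)
    (by simpa [sub_eq_zero] using conj_root_relation hs hT)
  exact ⟨ψ, hr, hb, hroot, hmono, s, hs, hψ⟩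

end Blocks

/-! ### The parametrized period. -/

theorem mainTheorem3 {L : Type*} [Field L] [NumberField L] (ρ : L →+* ℝ)
    (r b : ℕ) (hr : 1 ≤ r) (hb : Squarefree b)
    (θ : 𝓞 L) (hroot : aeval θ (cubicTrinomial r b) = 0)
    (hgen : IntermediateField.adjoin ℚ {(θ : L)} = ⊤)
    (hmono : Algebra.adjoin ℤ {θ} = ⊤) :
    (∃ c : ℤ → 𝓞 L, IsVoronoiChain ρ c) ∧
    ∀ c : ℤ → 𝓞 L, IsVoronoiChain ρ c →
      (b = 1 →
        IsPrimitivePeriodLength c 1 ∧ IsMChain ρ 0 ∧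
        c 1 = θ ∧ c 2 = θ ^ 2 ∧ c 3 = θ ^ 3 ∧ θ ^ 3 = 1 - 3 * (r : 𝓞 L) * θ ∧
        Algebra.norm ℤ θ = 1 ∧ IsFundamentalUnit θ) ∧
      (2 ≤ b →
        (r < ⌈(b : ℚ) / 3⌉₊ →
          IsPrimitivePeriodLength c 2 ∧ IsMChain ρ 1 ∧
          c 1 = θ ∧ c 2 = 1 - 3 * (r : 𝓞 L) * θ) ∧
        (⌈(b : ℚ) / 3⌉₊ ≤ r →
          IsPrimitivePeriodLength c 3 ∧ IsMChain ρ 2 ∧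
          c 1 = θ ∧ c 2 = θ ^ 2 ∧ c 3 = 1 - 3 * (r : 𝓞 L) * θ) ∧
        Algebra.norm ℤ θ = (b : ℤ) ∧ Algebra.norm ℤ (θ ^ 2) = (b : ℤ) ^ 2 ∧
        Algebra.norm ℤ (1 - 3 * (r : 𝓞 L) * θ) = 1 ∧
        IsFundamentalUnit (1 - 3 * (r : 𝓞 L) * θ) ∧
        ∀ α : 𝓞 L, IsLatticeMinimum α → ¬ IsUnit α → IsDifferentialPrincipalFactor α) := by
  have hb1 : 1 ≤ b := Nat.one_le_iff_ne_zero.2 hb.ne_zero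
  obtain ⟨ψ, h⟩ := exists_isTrinomialOrder ρ hr hb1 hroot hmono
  rcases hb1.eq_or_lt with rfl | hb2
  -- For `b = 1` the unit `1 - 3rθ` is the cube `θ³`, so `θ` is itself a unit and closes a block of
  -- length `1`.
  · obtain ⟨u, hu⟩ : ∃ u : (𝓞 L)ˣ, (u : 𝓞 L) = θ := by
      obtain ⟨v, hv⟩ := exists_unit_eq hroot
      have h3 := cube_eq hroot
      rw [← hv, Nat.cast_one, one_mul] at h3
      exact (isUnit_pow_iff three_ne_zero).1 (h3 ▸ v.isUnit)
    have B := h.block_one hu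
    refine ⟨⟨_, B.isVoronoiChain⟩, fun c hc => ?_⟩
    obtain rfl := B.eq_chain hc
    have hval (k : ℕ) : periodicChain u 1 (fun j => θ ^ j) k = θ ^ k := by
      have := B.chain_apply k (Nat.zero_le 1)
      simpa [hu] using this
    refine ⟨fun _ => ⟨B.isPrimitivePeriodLength (by omega), ?_, ?_, ?_, ?_, ?_, ?_, ?_⟩,
      fun h => absurd h (by omega)⟩
    · rw [IsMChain, B.orbits_eq (by omega) (by omega)]
      simp
    · simpa using hval 1
    · simpa using hval 2
    · simpa using hval 3
    · simpa using cube_eq hroot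
    · simpa using norm_generator hr le_rfl hroot hmono
    · exact hu ▸ B.isFundamentalUnit (by omega)
  · obtain ⟨u, hu⟩ := exists_unit_eq hroot
    have hnu := not_isUnit_generator hr hb2 hroot hmono
    have hnu2 : ¬ IsUnit (θ ^ 2) := fun h => hnu ((isUnit_pow_iff two_ne_zero).1 h)
    have hd1 : IsDifferentialPrincipalFactor θ := by
      simpa using isDifferentialPrincipalFactor_pow hr hb1 hroot hgen hmono (j := 1)
        (by norm_num) (by norm_num)
    have hd2 := isDifferentialPrincipalFactor_pow hr hb1 hroot hgen hmono (j := 2)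
      (by norm_num) (by norm_num)
    have hN := norm_generator hr hb1 hroot hmono
    have hN2 : Algebra.norm ℤ (θ ^ 2) = (b : ℤ) ^ 2 := by rw [map_pow, hN]
    have hNε := norm_unit hr hb1 hroot hgen hmono
    -- For integers `r < ⌈b/3⌉` means `3r < b`.
    rcases lt_or_ge (3 * r) b with hbr | hbr
    · have hceil : r < ⌈(b : ℚ) / 3⌉₊ := by
        rw [Nat.lt_ceil, lt_div_iff₀ (by norm_num)]
        exact_mod_cast (by omega : r * 3 < b)
      have B := h.block_two hbr hu
      have hnu' : ∀ j, 0 < j → j < 2 → ¬ IsUnit ([1, θ].getD j (1 - 3 * (r : 𝓞 L) * θ)) := by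
        intro j h0 hj
        obtain rfl : j = 1 := by omega
        exact hnu
      have hd : ∀ j, 0 < j → j < 2 →
          IsDifferentialPrincipalFactor ([1, θ].getD j (1 - 3 * (r : 𝓞 L) * θ)) := by
        intro j h0 hj
        obtain rfl : j = 1 := by omega
        exact hd1
      refine ⟨⟨_, B.isVoronoiChain⟩, fun c hc => ?_⟩
      obtain rfl := B.eq_chain hc
      refine ⟨fun h => absurd h (by omega), fun _ => ⟨fun _ => ⟨B.isPrimitivePeriodLength hnu',
        ?_, B.chain_natCast one_le_two, B.chain_natCast le_rfl⟩,
        fun h => absurd h (not_le.2 hceil), hN, hN2, hNε, hu ▸ B.isFundamentalUnit hnu',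
        fun α => B.isDifferentialPrincipalFactor hd⟩⟩
      have hI : Set.Ioo 0 2 = {1} := by ext j; simp; omega
      rw [IsMChain, B.orbits_eq hnu' hd, hI, Set.image_singleton, Set.encard_singleton]
      rfl
    · have hceil : ⌈(b : ℚ) / 3⌉₊ ≤ r := by
        rw [Nat.ceil_le, div_le_iff₀ (by norm_num)]
        exact_mod_cast (by omega : b ≤ r * 3)
      have B := h.block_three hbr hu
      have hnu' : ∀ j, 0 < j → j < 3 →
          ¬ IsUnit ([1, θ, θ ^ 2].getD j (1 - 3 * (r : 𝓞 L) * θ)) := by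
        intro j h0 hj
        obtain rfl | rfl : j = 1 ∨ j = 2 := by omega
        exacts [hnu, hnu2]
      have hd : ∀ j, 0 < j → j < 3 →
          IsDifferentialPrincipalFactor ([1, θ, θ ^ 2].getD j (1 - 3 * (r : 𝓞 L) * θ)) := by
        intro j h0 hj
        obtain rfl | rfl : j = 1 ∨ j = 2 := by omega
        exacts [hd1, hd2]
      refine ⟨⟨_, B.isVoronoiChain⟩, fun c hc => ?_⟩
      obtain rfl := B.eq_chain hc
      refine ⟨fun h => absurd h (by omega), fun _ => ⟨fun h => absurd h (not_lt.2 hceil),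
        fun _ => ⟨B.isPrimitivePeriodLength hnu', ?_, B.chain_natCast (by norm_num),
        B.chain_natCast (by norm_num), B.chain_natCast le_rfl⟩,
        hN, hN2, hNε, hu ▸ B.isFundamentalUnit hnu',
        fun α => B.isDifferentialPrincipalFactor hd⟩⟩
      have hI : Set.Ioo 0 3 = {1, 2} := by ext j; simp; omega
      rw [IsMChain, B.orbits_eq hnu' hd, hI, Set.image_pair, Set.encard_pair]
      · rfl
      -- The two orbits differ: `θ² = wθ` with a unit `w` would make `θ` a unit.
      · intro he
        have hmem : θ ^ 2 ∈ positiveUnitOrbit ρ θ :=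
          he.symm ▸ positiveUnitOrbit_self_mem ρ (θ ^ 2)
        obtain ⟨w, -, hw⟩ := hmem
        have : θ = w := mul_right_cancel₀ hd1.1.1 (by rw [← hw]; ring)
        exact hnu (this ▸ w.isUnit)
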